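/- Let $(X,\omega_X)$ be a connected Kähler manifold of complex dimension $n$, let $1\le k\le n$, and let $(Y,\omega_Y)$ be a toric Kähler manifold of complex dimension $n-k$: a complex manifold with a holomorphic $(\mathbb C^*)^{n-k}$-action having an open dense free orbit $Y_0$, and with a Kähler form for which the action of the compact torus $T^{n-k}$ is Hamiltonian. Put $E=Y\setminus Y_0$. For a function $h$ the Hamiltonian vector field $V_h$ is defined by $\iota_{V_h}\omega=dh$, and $\{g,h\}=\omega(V_g,V_h)$. Suppose $X$ carries a pseudotoric structure over $Y$, that is: * a Hamiltonian $T^k$-action on $(X,\omega_X)$, with (invariant) moment map $\mu:X\to\mathrm{Lie}(T^k)^*$, whose generating vector fields form a space of dimension $k$ (no nonzero element of $\mathrm{Lie}(T^k)$ generates the zero vector field); * a meromorphic map $F:X\dashrightarrow Y$ whose base (indeterminacy) locus $B$ is a $T^k$-invariant analytic subset which is empty or of complex dimension $k-1$, such that the holomorphic map $F:X\setminus B\to Y$ is $T^k$-invariant; * for every smooth function $h:Y\to\mathbb R$ there is a function $\varphi:X\setminus B\to\mathbb R$ such that, at all points of $X\setminus B$ where $F$ is a submersion, $V_{F^*h}=\varphi\cdot\nabla_F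 V_h$, where $\nabla_FV_h$ is the horizontal lift of $V_h$ (the lift that is $\omega_X$-orthogonal to $\ker dF$). Let $\Omega_X$ be a meromorphic $n$-form on $X$ without zeros and with simple poles exactly along a reduced (hence anticanonical) divisor $D\subset X$. Fix a basis of $\mathrm{Lie}(T^k)$, with generating vector fields $V_1,\dots,V_k$ on $X$ and components $\mu_1,\dots,\mu_k$ of $\mu$, so that $\iota_{V_i}\omega_X=d\mu_i$. Let $f_1,\dots,f_{n-k}$ be meromorphic functions on $Y$ which are holomorphic on $Y_0$. Assume: 1. $D$ is $T^k$-invariant; 2. $B\subset D$ and $F(X\setminus D)\subset Y\setminus E=Y_0$; 3. the functions $F^*f_j$ have no zeros on $X\setminus D$, and there $\iota_{V_1}\cdots\iota_{V_k}\Omega_X=d\log F^*f_1\wedge\cdots\wedge d\log F^*f_{n-k}$; 4. the functions $\nu_j=|f_j|$ Poisson commute pairwise with respect to $\omega_Y$ on $Y_0$ (at the points where the two functions concerned do not vanish). Then $$\rho=(\mu_1,\dots,\mu_k,F^*\nu_1,\dots,F^*\nu_{n-k}):X\setminus D\to\mathbb R^n$$ is a special Lagrangian fibration on $X\setminus D$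 (possibly with singular fibres): $\rho$ is smooth, its components Poisson commute, $\rho$ is a submersion on an open dense subset of $X\setminus D$, and there is $\theta\in\mathbb R$ such that the set of regular points of every fibre of $\rho$ is a Lagrangian submanifold $L$ with $\operatorname{Im}(e^{\sqrt{-1}\,\theta}\Omega_X)|_L=0$. -/

import Mathlib

open scoped Manifold ContDiff Topology

noncomputable section

/-!
Throughout, a complex manifold is a type `X` charted on a finite-dimensional complex normed space
`E` with complex-analytic transition maps (`IsManifold 𝓘(ℂ, E) ω X`).  In Mathlib the tangent space
of `X` at `x` is (by definition) the model space `E`, the identification being given by the chart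
`chartAt E x`; this holds for `X` as a complex manifold (model `𝓘(ℂ, E)`) and as the underlying real
manifold (model `𝓘(ℝ, E)`).  The complex structure of `T_x X` is multiplication by `Complex.I`.
Hence a `p`-form on `X` is a function `X → E [⋀^Fin p]→L[𝕜] 𝕜`.
-/

section Forms

variable {E : Type*} [NormedAddCommGroup E] {X : Type*} [TopologicalSpace X] [ChartedSpace E X]

/-- The coordinate expression of a differential form `η` in the chart around `x₀`: its pullback
under the inverse of the chart. -/
def formInChart (𝕜 : Type*) [NontriviallyNormedField 𝕜] [NormedSpace 𝕜 E] {p : ℕ}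
    (η : X → E [⋀^Fin p]→L[𝕜] 𝕜) (x₀ : X) (u : E) : E [⋀^Fin p]→L[𝕜] 𝕜 :=
  (η ((chartAt E x₀).symm u)).compContinuousLinearMap
    (mfderiv 𝓘(𝕜, E) 𝓘(𝕜, E) (chartAt E x₀).symm u : E →L[𝕜] E)

variable [NormedSpace ℂ E]

/-- `κ` is a Kähler form: a smooth closed real 2-form of type (1,1) which is positive. -/
structure IsKahlerForm (κ : X → E [⋀^Fin 2]→L[ℝ] ℝ) : Prop where
  smooth : ∀ x₀ : X, ContDiffOn ℝ ∞ (formInChart ℝ κ x₀) (chartAt E x₀).target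
  closed : ∀ x₀ : X, ∀ u ∈ (chartAt E x₀).target, extDeriv (formInChart ℝ κ x₀) u = 0
  type_one_one : ∀ (x : X) (v w : E), κ x ![Complex.I • v, Complex.I • w] = κ x ![v, w]
  pos : ∀ (x : X) (v : E), v ≠ 0 → 0 < κ x ![v, Complex.I • v]

/-- `η` is a holomorphic `p`-form on the open set `U`. -/
def IsHolomorphicFormOn {p : ℕ} (η : X → E [⋀^Fin p]→L[ℂ] ℂ) (U : Set X) : Prop :=
  ∀ x₀ : X, ContDiffOn ℂ ω (formInChart ℂ η x₀)
    ((chartAt E x₀).target ∩ (chartAt E x₀).symm ⁻¹' U)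

/-- `v` is the value at `x` of the Hamiltonian vector field `V_h` of `h`: `ι_{V_h} κ = dh`. -/
def IsHamiltonianVector (κ : X → E [⋀^Fin 2]→L[ℝ] ℝ) (h : X → ℝ) (x : X) (v : E) : Prop :=
  ∀ w : E, κ x ![v, w] = (mfderiv 𝓘(ℝ, E) 𝓘(ℝ, ℝ) h x : E →L[ℝ] ℝ) w

/-- The Poisson bracket `{g, h} = κ(V_g, V_h)` vanishes at `x`. -/
def PoissonCommuteAt (κ : X → E [⋀^Fin 2]→L[ℝ] ℝ) (g h : X → ℝ) (x : X) : Prop :=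
  ∀ v w : E, IsHamiltonianVector κ g x v → IsHamiltonianVector κ h x w → κ x ![v, w] = 0

end Forms

section TorusActions

/-- The exponential map `ℝᵏ = Lie(Tᵏ) → Tᵏ` of the compact torus. -/
def torusExp {k : ℕ} (s : Fin k → ℝ) : Fin k → Circle := fun i => Circle.exp (s i)

/-- The exponential map `ℂᵐ → (ℂˣ)ᵐ` of the complex torus. -/
def complexTorusExp {m : ℕ} (z : Fin m → ℂ) : Fin m → ℂˣ :=
  fun i => Units.mk0 (Complex.exp (z i)) (Complex.exp_ne_zero (z i))

/-- The inclusion `Tᵐ → (ℂˣ)ᵐ` of the compact torus. -/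
def torusInclusion {m : ℕ} (t : Fin m → Circle) : Fin m → ℂˣ := fun i => Circle.toUnits (t i)

variable {E : Type*} [NormedAddCommGroup E] [NormedSpace ℂ E]
  {X : Type*} [TopologicalSpace X] [ChartedSpace E X]

/-- The vector field on `X` generated by `v ∈ Lie(Tᵏ)`: the velocity of `s ↦ exp(sv) · x`. -/
def fundamentalVectorField {k : ℕ} (act : (Fin k → Circle) → X → X) (v : Fin k → ℝ) (x : X) : E :=
  (mfderiv 𝓘(ℝ, ℝ) 𝓘(ℝ, E) (fun s : ℝ => act (torusExp (s • v)) x) 0 : ℝ →L[ℝ] E) 1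

/-- `act` is a Hamiltonian action of `Tᵏ` on `(X, κ)` with moment map `μ : X → Lie(Tᵏ)*`.
Smoothness of the action is expressed through the covering `ℝᵏ → Tᵏ`. -/
structure IsHamiltonianTorusAction {k : ℕ} (κ : X → E [⋀^Fin 2]→L[ℝ] ℝ)
    (act : (Fin k → Circle) → X → X) (μ : X → (Fin k → ℝ) →L[ℝ] ℝ) : Prop where
  one_act : ∀ x, act 1 x = x
  mul_act : ∀ s t x, act (s * t) x = act s (act t x)
  smooth_act : ContMDiff (𝓘(ℝ, Fin k → ℝ).prod 𝓘(ℝ, E)) 𝓘(ℝ, E) ∞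
    (fun p : (Fin k → ℝ) × X => act (torusExp p.1) p.2)
  symplectic : ∀ (t : Fin k → Circle) (x : X) (v w : E),
    κ (act t x) ![(mfderiv 𝓘(ℝ, E) 𝓘(ℝ, E) (act t) x : E →L[ℝ] E) v,
      (mfderiv 𝓘(ℝ, E) 𝓘(ℝ, E) (act t) x : E →L[ℝ] E) w] = κ x ![v, w]
  smooth_moment : ContMDiff 𝓘(ℝ, E) 𝓘(ℝ, (Fin k → ℝ) →L[ℝ] ℝ) ∞ μ
  moment_invariant : ∀ t x, μ (act t x) = μ x
  moment_eq : ∀ (v : Fin k → ℝ) (x : X),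
    IsHamiltonianVector κ (fun y => μ y v) x (fundamentalVectorField act v x)

/-- A toric Kähler manifold of complex dimension `m`: a holomorphic action of `(ℂˣ)ᵐ` with an open
dense free orbit, and a Kähler form for which the action of the compact torus `Tᵐ ⊂ (ℂˣ)ᵐ` is
Hamiltonian. -/
structure ToricKahlerStructure (m : ℕ) (E : Type*) [NormedAddCommGroup E] [NormedSpace ℂ E]
    (Y : Type*) [TopologicalSpace Y] [ChartedSpace E Y] where
  form : Y → E [⋀^Fin 2]→L[ℝ] ℝ
  kahler : IsKahlerForm form
  act : (Fin m → ℂˣ) → Y → Y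
  one_act : ∀ y, act 1 y = y
  mul_act : ∀ s t y, act (s * t) y = act s (act t y)
  holomorphic_act : ContMDiff (𝓘(ℂ, Fin m → ℂ).prod 𝓘(ℂ, E)) 𝓘(ℂ, E) ω
    (fun p : (Fin m → ℂ) × Y => act (complexTorusExp p.1) p.2)
  basePoint : Y
  isOpen_orbit : IsOpen (Set.range fun t => act t basePoint)
  dense_orbit : Dense (Set.range fun t => act t basePoint)
  free_orbit : Function.Injective fun t => act t basePoint
  moment : Y → (Fin m → ℝ) →L[ℝ] ℝ
  hamiltonian : IsHamiltonianTorusAction form (fun t => act (torusInclusion t)) moment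

/-- The open dense orbit `Y₀ ≅ (ℂˣ)ᵐ`. -/
def ToricKahlerStructure.openOrbit {m : ℕ} {Y : Type*} [TopologicalSpace Y] [ChartedSpace E Y]
    (T : ToricKahlerStructure m E Y) : Set Y :=
  Set.range fun t => T.act t T.basePoint

/-- The toric anticanonical divisor: the complement of the open orbit. -/
def ToricKahlerStructure.toricDivisor {m : ℕ} {Y : Type*} [TopologicalSpace Y] [ChartedSpace E Y]
    (T : ToricKahlerStructure m E Y) : Set Y :=
  T.openOrbitᶜ

end TorusActions

section Analytic

/-- `A` is an analytic subset: locally the common zero set of finitely many holomorphic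
functions. -/
def IsAnalyticSubset {E : Type*} [NormedAddCommGroup E] [NormedSpace ℂ E] {H : Type*}
    [TopologicalSpace H] (I : ModelWithCorners ℂ E H) {M : Type*} [TopologicalSpace M]
    [ChartedSpace H M] (A : Set M) : Prop :=
  ∀ x : M, ∃ U : Set M, IsOpen U ∧ x ∈ U ∧ ∃ (N : ℕ) (g : M → Fin N → ℂ),
    ContMDiffOn I 𝓘(ℂ, Fin N → ℂ) ω g U ∧ A ∩ U = {y ∈ U | g y = 0}

variable {E : Type*} [NormedAddCommGroup E] [NormedSpace ℂ E]
  {X : Type*} [TopologicalSpace X] [ChartedSpace E X]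
  {E' : Type*} [NormedAddCommGroup E'] [NormedSpace ℂ E']
  {Y : Type*} [TopologicalSpace Y] [ChartedSpace E' Y]

/-- Near `x`, the set `A` is a complex submanifold of complex dimension `d`: the zero set of a
holomorphic submersion to `ℂᶜ`, where `d + c` is the dimension of the ambient manifold. -/
def IsComplexSubmanifoldNear (A : Set X) (d : ℕ) (x : X) : Prop :=
  ∃ c : ℕ, d + c = Module.finrank ℂ E ∧ ∃ U : Set X, IsOpen U ∧ x ∈ U ∧
    ∃ g : X → Fin c → ℂ, ContMDiffOn 𝓘(ℂ, E) 𝓘(ℂ, Fin c → ℂ) ω g U ∧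
      (∀ y ∈ U, Function.Surjective
        (mfderiv 𝓘(ℂ, E) 𝓘(ℂ, Fin c → ℂ) g y : E →L[ℂ] (Fin c → ℂ))) ∧
      A ∩ U = {y ∈ U | g y = 0}

/-- The analytic subset `A` has complex dimension `d`: the largest dimension of `A` at its regular
points is `d`. -/
def HasComplexDimension (A : Set X) (d : ℕ) : Prop :=
  (∃ x ∈ A, IsComplexSubmanifoldNear (E := E) A d x) ∧
    ∀ x ∈ A, ∀ e : ℕ, IsComplexSubmanifoldNear (E := E) A e x → e ≤ d

/-- `F : X ⇢ Y` is a meromorphic map (in the sense of Remmert) with base locus, i.e. indeterminacy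
locus, `B`.  The values of the function `F` on `B` are irrelevant. -/
structure IsMeromorphicMap (F : X → Y) (B : Set X) : Prop where
  analytic_base : IsAnalyticSubset 𝓘(ℂ, E) B
  dense_compl : Dense Bᶜ
  holomorphic : ContMDiffOn 𝓘(ℂ, E) 𝓘(ℂ, E') ω F Bᶜ
  analytic_graph : IsAnalyticSubset (𝓘(ℂ, E).prod 𝓘(ℂ, E'))
    (closure {p : X × Y | p.1 ∉ B ∧ p.2 = F p.1})
  proper_graph :
    IsProperMap fun p : closure {p : X × Y | p.1 ∉ B ∧ p.2 = F p.1} => p.1.1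
  not_extendable : ∀ x ∈ B, ∀ U : Set X, IsOpen U → x ∈ U →
    ¬ ∃ G : X → Y, ContMDiffOn 𝓘(ℂ, E) 𝓘(ℂ, E') ω G U ∧ Set.EqOn G F (U \ B)

/-- `f` is a meromorphic function: locally a quotient of holomorphic functions whose denominator
does not vanish identically on any open set.  Values at points where no such quotient has a
nonvanishing denominator are irrelevant. -/
def IsMeromorphicFunction (f : Y → ℂ) : Prop :=
  ∀ y : Y, ∃ U : Set Y, IsOpen U ∧ y ∈ U ∧ ∃ g h : Y → ℂ,
    ContMDiffOn 𝓘(ℂ, E') 𝓘(ℂ, ℂ) ω g U ∧ ContMDiffOn 𝓘(ℂ, E') 𝓘(ℂ, ℂ) ω h U ∧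
    U ⊆ closure {z ∈ U | h z ≠ 0} ∧ ∀ z ∈ U, h z ≠ 0 → f z = g z / h z

/-- `Ω` is a meromorphic `n`-form on `X` (`n = dim X`) without zeros and with simple poles exactly
along the reduced divisor `D`: near every point, `D = {s = 0}` for a holomorphic `s` whose
differential is nonzero on a dense subset of `D`, and `s Ω` extends to a nowhere vanishing
holomorphic `n`-form `η`.  In particular `Ω⁻¹` is a holomorphic section of `-K_X` with divisor `D`,
so that `D` is an anticanonical divisor.  The values of `Ω` on `D` are irrelevant. -/
def IsVolumeFormWithSimplePoles {n : ℕ} (Ω : X → E [⋀^Fin n]→L[ℂ] ℂ) (D : Set X) : Prop :=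
  ∀ x : X, ∃ U : Set X, IsOpen U ∧ x ∈ U ∧ ∃ (s : X → ℂ) (η : X → E [⋀^Fin n]→L[ℂ] ℂ),
    ContMDiffOn 𝓘(ℂ, E) 𝓘(ℂ, ℂ) ω s U ∧
    D ∩ U = {y ∈ U | s y = 0} ∧
    D ∩ U ⊆ closure {y ∈ D ∩ U | (mfderiv 𝓘(ℂ, E) 𝓘(ℂ, ℂ) s y : E →L[ℂ] ℂ) ≠ 0} ∧
    IsHolomorphicFormOn η U ∧ (∀ y ∈ U, η y ≠ 0) ∧ ∀ y ∈ U \ D, η y = s y • Ω y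

/-- The logarithmic differential `d log g` at `x`. -/
def dlog (g : X → ℂ) (x : X) : E →L[ℂ] ℂ :=
  (g x)⁻¹ • (mfderiv 𝓘(ℂ, E) 𝓘(ℂ, ℂ) g x : E →L[ℂ] ℂ)

/-- The value `(α₁ ∧ ⋯ ∧ α_m)(w₁, …, w_m) = det (α_i(w_j))`. -/
def wedgeApply {m : ℕ} (α : Fin m → E →L[ℂ] ℂ) (w : Fin m → E) : ℂ :=
  Matrix.det (Matrix.of fun i j => α i (w j))

end Analytic

section Pseudotoric

variable {E : Type*} [NormedAddCommGroup E] [NormedSpace ℂ E]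
  {X : Type*} [TopologicalSpace X] [ChartedSpace E X]
  {E' : Type*} [NormedAddCommGroup E'] [NormedSpace ℂ E']
  {Y : Type*} [TopologicalSpace Y] [ChartedSpace E' Y]

/-- `w ∈ T_x X` is the horizontal lift of `u ∈ T_{F(x)} Y` for the symplectic connection of `F`: it
projects to `u` and is `κ`-orthogonal to `ker dF`. -/
def IsHorizontalLift (κ : X → E [⋀^Fin 2]→L[ℝ] ℝ) (F : X → Y) (x : X) (u : E') (w : E) : Prop :=
  (mfderiv 𝓘(ℝ, E) 𝓘(ℝ, E') F x : E →L[ℝ] E') w = u ∧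
    ∀ v : E, (mfderiv 𝓘(ℝ, E) 𝓘(ℝ, E') F x : E →L[ℝ] E') v = 0 → κ x ![w, v] = 0

/-- A pseudotoric structure on the Kähler manifold `(X, κ)`, with values in the toric Kähler
manifold `(Y, T)` of dimension `m` (the rank). -/
structure PseudotoricStructure (k : ℕ) {m : ℕ} (κ : X → E [⋀^Fin 2]→L[ℝ] ℝ)
    (T : ToricKahlerStructure m E' Y) where
  act : (Fin k → Circle) → X → X
  moment : X → (Fin k → ℝ) →L[ℝ] ℝ
  hamiltonian : IsHamiltonianTorusAction κ act moment
  /-- The generating vector fields of a basis of `Lie(Tᵏ)` are linearly independent vector fields,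
  i.e. only finitely many elements of `Tᵏ` act trivially. -/
  locally_effective : ∀ v : Fin k → ℝ,
    (∀ x : X, (fundamentalVectorField act v x : E) = 0) → v = 0
  map : X → Y
  base : Set X
  meromorphic : IsMeromorphicMap (E := E) (E' := E') map base
  base_invariant : ∀ t, ∀ x ∈ base, act t x ∈ base
  /-- The base locus has dimension `k - 1`, or is empty (as it is if `Y` is a point). -/
  base_dim : base = ∅ ∨ HasComplexDimension (E := E) base (k - 1)
  map_invariant : ∀ t, ∀ x ∉ base, map (act t x) = map x
  /-- `V_{F^* h}` is a multiple of the horizontal lift of `V_h`, wherever `F` is a submersion. -/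
  parallel : ∀ h : Y → ℝ, ContMDiff 𝓘(ℝ, E') 𝓘(ℝ, ℝ) ∞ h → ∃ f : X → ℝ, ∀ x ∉ base,
    Function.Surjective (mfderiv 𝓘(ℝ, E) 𝓘(ℝ, E') map x : E →L[ℝ] E') →
    ∀ (VFh : E) (Vh : E') (w : E), IsHamiltonianVector κ (h ∘ map) x VFh →
      IsHamiltonianVector T.form h (map x) Vh → IsHorizontalLift κ map x Vh w →
      VFh = f x • w

end Pseudotoric

section SpecialLagrangian

variable {E : Type*} [NormedAddCommGroup E] [NormedSpace ℂ E]
  {X : Type*} [TopologicalSpace X] [ChartedSpace E X]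

/-- `L` is a special Lagrangian submanifold of phase `θ` of the `n`-dimensional complex manifold
`X`: near each of its points, `L` is the zero set of a smooth submersion `g` to `ℝⁿ`, and on the
tangent spaces `T_y L = ker dg_y` (of real dimension `n`) both `κ` and `Im (e^{iθ} Ω)` vanish. -/
def IsSpecialLagrangian {n : ℕ} (κ : X → E [⋀^Fin 2]→L[ℝ] ℝ) (Ω : X → E [⋀^Fin n]→L[ℂ] ℂ)
    (θ : ℝ) (L : Set X) : Prop :=
  ∀ x ∈ L, ∃ U : Set X, IsOpen U ∧ x ∈ U ∧ ∃ g : X → Fin n → ℝ,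
    ContMDiffOn 𝓘(ℝ, E) 𝓘(ℝ, Fin n → ℝ) ∞ g U ∧
    (∀ y ∈ U, Function.Surjective
      (mfderiv 𝓘(ℝ, E) 𝓘(ℝ, Fin n → ℝ) g y : E →L[ℝ] (Fin n → ℝ))) ∧
    L ∩ U = {y ∈ U | g y = 0} ∧
    ∀ y ∈ L ∩ U,
      (∀ v w : E, (mfderiv 𝓘(ℝ, E) 𝓘(ℝ, Fin n → ℝ) g y : E →L[ℝ] (Fin n → ℝ)) v = 0 →
        (mfderiv 𝓘(ℝ, E) 𝓘(ℝ, Fin n → ℝ) g y : E →L[ℝ] (Fin n → ℝ)) w = 0 →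
        κ y ![v, w] = 0) ∧
      (∀ v : Fin n → E,
        (∀ i, (mfderiv 𝓘(ℝ, E) 𝓘(ℝ, Fin n → ℝ) g y : E →L[ℝ] (Fin n → ℝ)) (v i) = 0) →
        (Complex.exp (θ * Complex.I) * Ω y v).im = 0)

/-- The points of `U` at which `ρ` is a submersion. -/
def regularLocus {n : ℕ} (ρ : X → Fin n → ℝ) (U : Set X) : Set X :=
  {x ∈ U | Function.Surjective
    (mfderiv 𝓘(ℝ, E) 𝓘(ℝ, Fin n → ℝ) ρ x : E →L[ℝ] (Fin n → ℝ))}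

/-- `ρ` is a special Lagrangian fibration (singular fibres being allowed) on the open set `U`: a
smooth map with Poisson commuting components, which is a submersion on an open dense subset of `U`,
and such that for some `θ` every fibre is, at the regular points of `ρ`, a special Lagrangian
submanifold of phase `θ`.  (Fibres over regular values consist of regular points only.) -/
structure IsSpecialLagrangianFibrationOn {n : ℕ} (κ : X → E [⋀^Fin 2]→L[ℝ] ℝ)
    (Ω : X → E [⋀^Fin n]→L[ℂ] ℂ) (ρ : X → Fin n → ℝ) (U : Set X) : Prop where
  isOpen : IsOpen U
  smooth : ContMDiffOn 𝓘(ℝ, E) 𝓘(ℝ, Fin n → ℝ) ∞ ρ U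
  poisson : ∀ i j, ∀ x ∈ U, PoissonCommuteAt κ (fun y => ρ y i) (fun y => ρ y j) x
  isOpen_regular : IsOpen (regularLocus (E := E) ρ U)
  dense_regular : U ⊆ closure (regularLocus (E := E) ρ U)
  special : ∃ θ : ℝ, ∀ b : Fin n → ℝ,
    IsSpecialLagrangian κ Ω θ {x ∈ regularLocus (E := E) ρ U | ρ x = b}

end SpecialLagrangian

end

/-! Consider a point outside `D` with finite stabilizer. Invariance of the moment map makes the span
of V_1, …, V_k isotropic, hence totally real, because ω(v, iv) > 0
(`LinearIndependent.complex_of_isotropic`). So the V_i are independent over ℂ, and contracting the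
nonzero top form Ω with them leaves a nonzero m-form. By (iii) the forms d log F^*f_j are then
independent. They factor through dF, whose target has dimension m, so dF is onto. Hence the
pseudotoric condition applies: V_{F^*h} is a multiple of a lift of V_h, and commuting functions on
`Y` pull back to commuting functions (`PseudotoricStructure.poissonCommuteAt_comp`). By continuity
of the bracket this extends to all of `Dᶜ`. Brackets with a component of μ vanish by invariance.

At the same points ρ is a submersion (`surjective_of_dual_of_re`). A relation among its
differentials reads ω(W, ·) + Re β = 0, with W in the real span of the V_i and β complex-linear with
β(W) = 0. Evaluating at iW gives W = 0, then β = 0.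

At any regular point, ker dρ is Lagrangian and has as basis the Hamiltonian vectors of the
components of ρ. On it Ω equals, up to sign, the determinant of d log F^*f_i on V_{F^*ν_j}.
Commutation kills Re d log F^*f_i = d log F^*ν_i, so the entries are imaginary, the determinant lies
in i^m ℝ, and θ = -mπ/2 serves everywhere.

What remains is that finite stabilizers occur densely
(`IsHamiltonianTorusAction.dense_injective_orbitDeriv`). The torus action is only assumed smooth, so
analytic continuation is not available. A nonzero stabilizer algebra contains a nonzero integral
vector, so the bad set is a countable union of closed sets and Baire's theorem applies. If an
integral vector field vanishes on an open set, its flow at rational multiples of 2π consists of maps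
of finite order fixing that set. Such maps are the identity (`eq_id_of_iterate_eq_id`), so the field
is zero, against local effectiveness. -/

/-- The differential of a map between real manifolds, as a linear map between the model spaces. -/
noncomputable def realMFDeriv (E E' : Type*) [NormedAddCommGroup E] [NormedSpace ℝ E]
    [NormedAddCommGroup E'] [NormedSpace ℝ E'] {X Y : Type*} [TopologicalSpace X]
    [ChartedSpace E X] [TopologicalSpace Y] [ChartedSpace E' Y] (f : X → Y) (x : X) :
    E →L[ℝ] E' :=
  mfderiv 𝓘(ℝ, E) 𝓘(ℝ, E') f x

/-! ### From complex to real differentiability. -/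

section RestrictScalars

variable {E : Type*} [NormedAddCommGroup E] [NormedSpace ℂ E]
  {X : Type*} [TopologicalSpace X] [ChartedSpace E X]
  {E' : Type*} [NormedAddCommGroup E'] [NormedSpace ℂ E']
  {Y : Type*} [TopologicalSpace Y] [ChartedSpace E' Y]

/-- The real manifold underlying a complex manifold. -/
theorem isManifold_real_of_complex (E : Type*) [NormedAddCommGroup E] [NormedSpace ℂ E]
    (X : Type*) [TopologicalSpace X] [ChartedSpace E X] [IsManifold 𝓘(ℂ, E) ω X] :
    IsManifold 𝓘(ℝ, E) ∞ X := by
  refine isManifold_of_contDiffOn _ _ _ fun e e' he he' => ?_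
  have h := (contDiffGroupoid ω 𝓘(ℂ, E)).compatible he he'
  rw [contDiffGroupoid, mem_groupoid_of_pregroupoid] at h
  exact (h.1.restrict_scalars ℝ).of_le le_top

theorem ContMDiffOn.real_of_complex {f : X → Y} {s : Set X}
    (h : ContMDiffOn 𝓘(ℂ, E) 𝓘(ℂ, E') ω f s) : ContMDiffOn 𝓘(ℝ, E) 𝓘(ℝ, E') ∞ f s := by
  intro x hx
  have h1 := contMDiffWithinAt_iff.1 (h x hx)
  refine contMDiffWithinAt_iff.2 ⟨h1.1, ?_⟩
  exact (h1.2.restrict_scalars ℝ).of_le le_top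

theorem HasMFDerivAt.real_of_complex {f : X → Y} {x : X} {f' : E →L[ℂ] E'}
    (h : HasMFDerivAt 𝓘(ℂ, E) 𝓘(ℂ, E') f x f') :
    HasMFDerivAt 𝓘(ℝ, E) 𝓘(ℝ, E') f x (f'.restrictScalars ℝ) :=
  ⟨h.1, HasFDerivWithinAt.restrictScalars ℝ h.2⟩

theorem realMFDeriv_eq {f : X → Y} {x : X} (h : MDifferentiableAt 𝓘(ℂ, E) 𝓘(ℂ, E') f x) :
    realMFDeriv E E' f x =
      ((mfderiv 𝓘(ℂ, E) 𝓘(ℂ, E') f x : E →L[ℂ] E')).restrictScalars ℝ :=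
  h.hasMFDerivAt.real_of_complex.mfderiv

end RestrictScalars

/-! ### Differentials read in a chart. -/

section Chart

variable {E : Type*} [NormedAddCommGroup E] [NormedSpace ℝ E]
  {X : Type*} [TopologicalSpace X] [ChartedSpace E X] [IsManifold 𝓘(ℝ, E) ∞ X]
  {V : Type*} [NormedAddCommGroup V] [NormedSpace ℝ V]

theorem mdifferentiableAt_chart_symm (x₀ : X) {u : E} (hu : u ∈ (chartAt E x₀).target) :
    MDifferentiableAt 𝓘(ℝ, E) 𝓘(ℝ, E) (chartAt E x₀).symm u :=
  haveI : IsManifold 𝓘(ℝ, E) 1 X := .of_le (n := ∞) (by simp)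
  mdifferentiableAt_atlas_symm (chart_mem_atlas E x₀) hu

theorem bijective_realMFDeriv_chart_symm (x₀ : X) {u : E} (hu : u ∈ (chartAt E x₀).target) :
    Function.Bijective (realMFDeriv E E (chartAt E x₀).symm u) :=
  haveI : IsManifold 𝓘(ℝ, E) 1 X := .of_le (n := ∞) (by simp)
  (mdifferentiable_chart (I := 𝓘(ℝ, E)) x₀).symm.mfderiv_bijective hu

theorem fderiv_comp_chart_symm {h : X → V} (x₀ : X) {u : E} (hu : u ∈ (chartAt E x₀).target)
    (hh : MDifferentiableAt 𝓘(ℝ, E) 𝓘(ℝ, V) h ((chartAt E x₀).symm u)) :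
    fderiv ℝ (h ∘ (chartAt E x₀).symm) u =
      (realMFDeriv E V h ((chartAt E x₀).symm u)).comp
        (realMFDeriv E E (chartAt E x₀).symm u) := by
  rw [← mfderiv_eq_fderiv]
  exact mfderiv_comp u hh (mdifferentiableAt_chart_symm x₀ hu)

theorem ContMDiffOn.contDiffOn_comp_chart_symm {h : X → V} {U : Set X}
    (hh : ContMDiffOn 𝓘(ℝ, E) 𝓘(ℝ, V) ∞ h U) (x₀ : X) :
    ContDiffOn ℝ ∞ (h ∘ (chartAt E x₀).symm)
      ((chartAt E x₀).target ∩ (chartAt E x₀).symm ⁻¹' U) := by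
  rw [← contMDiffOn_iff_contDiffOn]
  exact hh.comp ((contMDiffOn_chart_symm (I := 𝓘(ℝ, E)) (x := x₀)).mono Set.inter_subset_left)
    fun u hu => hu.2

theorem ContMDiffOn.continuousOn_fderiv_comp_chart_symm {h : X → V} {U : Set X}
    (hU : IsOpen U) (hh : ContMDiffOn 𝓘(ℝ, E) 𝓘(ℝ, V) ∞ h U) (x₀ : X) :
    ContinuousOn (fderiv ℝ (h ∘ (chartAt E x₀).symm))
      ((chartAt E x₀).target ∩ (chartAt E x₀).symm ⁻¹' U) :=
  (hh.contDiffOn_comp_chart_symm x₀).continuousOn_fderiv_of_isOpen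
    ((chartAt E x₀).isOpen_inter_preimage_symm hU) (by simp)

end Chart

section ChartClosure

variable {E : Type*} [NormedAddCommGroup E] {X : Type*} [TopologicalSpace X] [ChartedSpace E X]

theorem mem_closure_chart_target_inter {x : X} {S : Set X} (hx : x ∈ closure S) :
    chartAt E x x ∈ closure ((chartAt E x).target ∩ (chartAt E x).symm ⁻¹' S) := by
  rw [mem_closure_iff]
  intro W hW hxW
  obtain ⟨z, hz⟩ := mem_closure_iff.1 hx _ ((chartAt E x).isOpen_inter_preimage hW)
    ⟨mem_chart_source E x, hxW⟩
  exact ⟨chartAt E x z, hz.1.2, (chartAt E x).map_source hz.1.1,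
    by simpa [(chartAt E x).left_inv hz.1.1] using hz.2⟩

end ChartClosure

/-- Derivatives are typed between model spaces and the base point is matched by an equation, which
avoids transport between tangent spaces. -/
theorem HasMFDerivAt.comp_normed_of_eq {F₁ F₂ F₃ M₁ M₂ M₃ : Type*}
    [NormedAddCommGroup F₁] [NormedSpace ℝ F₁] [NormedAddCommGroup F₂] [NormedSpace ℝ F₂]
    [NormedAddCommGroup F₃] [NormedSpace ℝ F₃]
    [TopologicalSpace M₁] [ChartedSpace F₁ M₁] [TopologicalSpace M₂] [ChartedSpace F₂ M₂]
    [TopologicalSpace M₃] [ChartedSpace F₃ M₃] {g : M₂ → M₃} {f : M₁ → M₂} {x : M₁} {y : M₂}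
    {g' : F₂ →L[ℝ] F₃} {f' : F₁ →L[ℝ] F₂} (hg : HasMFDerivAt 𝓘(ℝ, F₂) 𝓘(ℝ, F₃) g y g')
    (hf : HasMFDerivAt 𝓘(ℝ, F₁) 𝓘(ℝ, F₂) f x f') (hy : f x = y) :
    HasMFDerivAt 𝓘(ℝ, F₁) 𝓘(ℝ, F₃) (g ∘ f) x (g'.comp f') := by
  subst hy
  exact HasMFDerivAt.comp x hg hf

theorem MDifferentiableAt.comp_hasMFDerivAt_zero {F₁ F₂ F₃ M₁ M₂ M₃ : Type*}
    [NormedAddCommGroup F₁] [NormedSpace ℝ F₁] [NormedAddCommGroup F₂] [NormedSpace ℝ F₂]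
    [NormedAddCommGroup F₃] [NormedSpace ℝ F₃]
    [TopologicalSpace M₁] [ChartedSpace F₁ M₁] [TopologicalSpace M₂] [ChartedSpace F₂ M₂]
    [TopologicalSpace M₃] [ChartedSpace F₃ M₃] {g : M₂ → M₃} {f : M₁ → M₂} {x : M₁} {y : M₂}
    (hg : MDifferentiableAt 𝓘(ℝ, F₂) 𝓘(ℝ, F₃) g y)
    (hf : HasMFDerivAt 𝓘(ℝ, F₁) 𝓘(ℝ, F₂) f x (0 : F₁ →L[ℝ] F₂)) (hy : f x = y) :
    HasMFDerivAt 𝓘(ℝ, F₁) 𝓘(ℝ, F₃) (g ∘ f) x (0 : F₁ →L[ℝ] F₃) := by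
  have h := hg.hasMFDerivAt.comp_normed_of_eq hf hy
  have h0 : ((mfderiv 𝓘(ℝ, F₂) 𝓘(ℝ, F₃) g y : F₂ →L[ℝ] F₃)).comp (0 : F₁ →L[ℝ] F₂) = 0 :=
    ContinuousLinearMap.comp_zero _
  exact h0 ▸ h

/-! ### Orbits and generating vector fields. -/

section TorusOrbits

theorem torusExp_zero {k : ℕ} : torusExp (0 : Fin k → ℝ) = 1 := by
  ext i; simp [torusExp]

theorem torusExp_add {k : ℕ} (s t : Fin k → ℝ) :
    torusExp (s + t) = torusExp s * torusExp t := by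
  ext i; simp [torusExp, Circle.exp_add]

theorem torusExp_two_pi_int {k : ℕ} (n : Fin k → ℤ) :
    torusExp (fun i => 2 * Real.pi * (n i : ℝ)) = 1 := by
  funext i
  simp only [torusExp, Pi.one_apply]
  rw [mul_comm]
  exact Circle.exp_int_mul_two_pi (n i)

variable {E : Type*} [NormedAddCommGroup E] [NormedSpace ℂ E]
  {X : Type*} [TopologicalSpace X] [ChartedSpace E X]

/-- The differential at `0` of the orbit map `u ↦ exp(u) · x`. -/
noncomputable def orbitDeriv (E : Type*) [NormedAddCommGroup E] [NormedSpace ℂ E]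
    {X : Type*} [TopologicalSpace X] [ChartedSpace E X] {k : ℕ}
    (act : (Fin k → Circle) → X → X) (x : X) :
    (Fin k → ℝ) →L[ℝ] E :=
  mfderiv 𝓘(ℝ, Fin k → ℝ) 𝓘(ℝ, E) (fun u => act (torusExp u) x) 0

variable {k : ℕ} {κ : X → E [⋀^Fin 2]→L[ℝ] ℝ} {act : (Fin k → Circle) → X → X}
  {μ : X → (Fin k → ℝ) →L[ℝ] ℝ}

namespace IsHamiltonianTorusAction

theorem act_torusExp_zero (h : IsHamiltonianTorusAction κ act μ) (x : X) :
    act (torusExp 0) x = x := by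
  rw [torusExp_zero, h.one_act]

theorem act_torusExp_add (h : IsHamiltonianTorusAction κ act μ) (s t : Fin k → ℝ) (x : X) :
    act (torusExp (s + t)) x = act (torusExp s) (act (torusExp t) x) := by
  rw [torusExp_add, h.mul_act]

theorem contMDiff_orbit (h : IsHamiltonianTorusAction κ act μ) (x : X) :
    ContMDiff 𝓘(ℝ, Fin k → ℝ) 𝓘(ℝ, E) ∞ fun u => act (torusExp u) x :=
  h.smooth_act.comp (contMDiff_id.prodMk contMDiff_const)

theorem contMDiff_act (h : IsHamiltonianTorusAction κ act μ) (u : Fin k → ℝ) :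
    ContMDiff 𝓘(ℝ, E) 𝓘(ℝ, E) ∞ (act (torusExp u)) :=
  h.smooth_act.comp (contMDiff_const.prodMk contMDiff_id)

theorem hasMFDerivAt_orbit (h : IsHamiltonianTorusAction κ act μ) (x : X) :
    HasMFDerivAt 𝓘(ℝ, Fin k → ℝ) 𝓘(ℝ, E) (fun u => act (torusExp u) x) 0 (orbitDeriv E act x) :=
  ((h.contMDiff_orbit x).mdifferentiable (by simp) 0).hasMFDerivAt

theorem hasMFDerivAt_curve (h : IsHamiltonianTorusAction κ act μ) (x : X) (v : Fin k → ℝ) :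
    HasMFDerivAt 𝓘(ℝ, ℝ) 𝓘(ℝ, E) (fun s : ℝ => act (torusExp (s • v)) x) 0
      ((orbitDeriv E act x).comp
        ((ContinuousLinearMap.id ℝ ℝ).smulRight v)) := by
  have h1 : HasMFDerivAt 𝓘(ℝ, ℝ) 𝓘(ℝ, Fin k → ℝ) (fun s : ℝ => s • v) 0
      ((ContinuousLinearMap.id ℝ ℝ).smulRight v) :=
    ((ContinuousLinearMap.id ℝ ℝ).smulRight v).hasFDerivAt.hasMFDerivAt
  exact (h.hasMFDerivAt_orbit x).comp_normed_of_eq h1 (zero_smul ℝ v)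

theorem fundamentalVectorField_eq (h : IsHamiltonianTorusAction κ act μ) (v : Fin k → ℝ)
    (x : X) : (fundamentalVectorField act v x : E) = orbitDeriv E act x v := by
  rw [fundamentalVectorField, (h.hasMFDerivAt_curve x v).mfderiv]
  change (orbitDeriv E act x) ((1 : ℝ) • v) = _
  rw [one_smul]

/-- Functions constant along an orbit are annihilated by the generating vector fields. -/
theorem realMFDeriv_orbitDeriv_eq_zero {V : Type*} [NormedAddCommGroup V] [NormedSpace ℝ V]
    (h : IsHamiltonianTorusAction κ act μ) {φ : X → V} {x : X}
    (hφ : MDifferentiableAt 𝓘(ℝ, E) 𝓘(ℝ, V) φ x) (hinv : ∀ t, φ (act t x) = φ x)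
    (v : Fin k → ℝ) :
    realMFDeriv E V φ x (orbitDeriv E act x v) = 0 := by
  have h1 := h.hasMFDerivAt_orbit x
  have h2 := hφ.hasMFDerivAt
  have h3 := h2.comp_normed_of_eq h1 (h.act_torusExp_zero x)
  have h4 : (φ ∘ fun u => act (torusExp u) x) = fun _ => φ x := by
    funext u; exact hinv _
  rw [h4] at h3
  have h5 := hasMFDerivAt_unique h3 (hasMFDerivAt_const (φ x) (0 : Fin k → ℝ))
  exact DFunLike.congr_fun h5 v

/-- The one-parameter group law carries zero velocity at time 0 to every time. The curve is
therefore constant in a chart for small times, and any time is an integer multiple of a small one.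
-/
theorem act_eq_self_of_orbitDeriv_eq_zero [T2Space X] [IsManifold 𝓘(ℝ, E) ∞ X]
    (h : IsHamiltonianTorusAction κ act μ)
    {x : X} {v : Fin k → ℝ} (hv : orbitDeriv E act x v = 0) (s : ℝ) :
    act (torusExp (s • v)) x = x := by
  set c : ℝ → X := fun s => act (torusExp (s • v)) x with hc
  have hc0 : c 0 = x := by simp [hc, h.act_torusExp_zero]
  have hadd : ∀ s t, c (s + t) = act (torusExp (s • v)) (c t) := fun s t => by
    simp only [hc, add_smul, h.act_torusExp_add]
  have hd0 : HasMFDerivAt 𝓘(ℝ, ℝ) 𝓘(ℝ, E) c 0 (0 : ℝ →L[ℝ] E) := by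
    have h1 := h.hasMFDerivAt_curve x v
    have h2 : (orbitDeriv E act x).comp ((ContinuousLinearMap.id ℝ ℝ).smulRight v) = 0 := by
      ext
      simp [hv]
    exact h2 ▸ h1
  have hd : ∀ s, HasMFDerivAt 𝓘(ℝ, ℝ) 𝓘(ℝ, E) c s (0 : ℝ →L[ℝ] E) := by
    intro s
    have h1 : HasMFDerivAt 𝓘(ℝ, ℝ) 𝓘(ℝ, ℝ) (fun t : ℝ => t - s) s
        (ContinuousLinearMap.id ℝ ℝ) :=
      ((hasFDerivAt_id s).sub_const s).hasMFDerivAt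
    have h0 : (0 : ℝ →L[ℝ] E).comp (ContinuousLinearMap.id ℝ ℝ) = 0 :=
      ContinuousLinearMap.zero_comp _
    have h2 : HasMFDerivAt 𝓘(ℝ, ℝ) 𝓘(ℝ, E) (c ∘ fun t => t - s) s (0 : ℝ →L[ℝ] E) :=
      h0 ▸ hd0.comp_normed_of_eq h1 (sub_self s)
    have h3 := (h.contMDiff_act (s • v)).mdifferentiable (by simp) x
    have h4 := h3.comp_hasMFDerivAt_zero h2 (by simpa using hc0)
    have h5 : (act (torusExp (s • v)) ∘ c ∘ fun t => t - s) = c := by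
      funext t
      have := hadd s (t - s)
      rw [add_sub_cancel] at this
      exact this.symm
    rwa [h5] at h4
  have hcont : Continuous c := continuous_iff_continuousAt.2 fun s => (hd s).1
  obtain ⟨δ, hδ, hsub⟩ := Metric.mem_nhds_iff.1 (hcont.continuousAt.preimage_mem_nhds
    (by rw [hc0]; exact chart_source_mem_nhds E x : (chartAt E x).source ∈ 𝓝 (c 0)))
  have : IsManifold 𝓘(ℝ, E) 1 X := .of_le (n := ∞) (by simp)
  have hloc : ∀ t ∈ Metric.ball (0 : ℝ) δ, c t = x := by
    intro t ht
    have hder : ∀ r ∈ Metric.ball (0 : ℝ) δ,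
        HasFDerivAt (fun r => chartAt E x (c r)) (0 : ℝ →L[ℝ] E) r := by
      intro r hr
      have h1 := mdifferentiableAt_atlas (I := 𝓘(ℝ, E)) (chart_mem_atlas E x) (hsub hr)
      exact (h1.comp_hasMFDerivAt_zero (hd r) rfl).hasFDerivAt
    have hconst := (convex_ball (0 : ℝ) δ).is_const_of_fderivWithin_eq_zero (𝕜 := ℝ)
      (fun r hr => (hder r hr).differentiableAt.differentiableWithinAt)
      (fun r hr => by
        rw [fderivWithin_of_isOpen Metric.isOpen_ball hr, (hder r hr).fderiv])
      ht (Metric.mem_ball_self hδ)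
    have := (chartAt E x).injOn (hsub ht) (hsub (Metric.mem_ball_self hδ)) hconst
    rw [this, hc0]
  have hmul : ∀ (t : ℝ) (N : ℕ), c t = x → c (N * t) = x := by
    intro t N ht
    induction N with
    | zero => simpa using hc0
    | succ N ih =>
      rw [Nat.cast_succ, add_mul, one_mul, hadd, ht]
      exact ih
  obtain ⟨N, hN⟩ := exists_nat_gt (|s| / δ)
  have hN0 : (0 : ℝ) < N := lt_of_le_of_lt (by positivity) hN
  have := hmul (s / N) N (hloc _ (by
    rw [mem_ball_zero_iff, Real.norm_eq_abs, abs_div, abs_of_pos hN0, div_lt_iff₀ hN0]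
    rwa [div_lt_iff₀ hδ, mul_comm] at hN))
  rwa [mul_div_cancel₀ _ hN0.ne'] at this

theorem orbitDeriv_eq_zero_iff [T2Space X] [IsManifold 𝓘(ℝ, E) ∞ X]
    (h : IsHamiltonianTorusAction κ act μ) {x : X} {v : Fin k → ℝ} :
    orbitDeriv E act x v = 0 ↔ ∀ s : ℝ, act (torusExp (s • v)) x = x := by
  refine ⟨h.act_eq_self_of_orbitDeriv_eq_zero, fun hs => ?_⟩
  have h1 := h.hasMFDerivAt_curve x v
  rw [show (fun s : ℝ => act (torusExp (s • v)) x) = fun _ => x from funext hs] at h1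
  have h2 := hasMFDerivAt_unique h1 (hasMFDerivAt_const x (0 : ℝ))
  have h3 : orbitDeriv E act x ((1 : ℝ) • v) = 0 := DFunLike.congr_fun h2 (1 : ℝ)
  rwa [one_smul] at h3

end IsHamiltonianTorusAction

end TorusOrbits

/-! ### Density of the points with finite stabilizer. -/

section TorusDensity

/-- Simultaneous approximation: some positive multiple of `w` is close to the lattice `2πℤᵏ`. -/
theorem exists_nat_mul_near_two_pi_int {k : ℕ} (w : Fin k → ℝ) {ε : ℝ} (hε : 0 < ε) :
    ∃ (N : ℕ) (n : Fin k → ℤ), 1 ≤ N ∧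
      ‖(N : ℝ) • w - fun i => 2 * Real.pi * (n i : ℝ)‖ < ε := by
  -- Pigeonhole by compactness: the multiples of w/2π modulo 1 have a Cauchy subsequence in the
  -- cube, and the difference of two close terms gives N and n.
  set y : ℕ → Fin k → ℝ := fun N i => Int.fract (N * w i / (2 * Real.pi)) with hy
  have hmem : ∀ N, y N ∈ Set.Icc (0 : Fin k → ℝ) 1 := fun N =>
    ⟨fun i => Int.fract_nonneg _, fun i => (Int.fract_lt_one _).le⟩
  obtain ⟨a, -, φ, hφ, hlim⟩ := isCompact_Icc.tendsto_subseq hmem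
  have hpi : 0 < 2 * Real.pi := by positivity
  obtain ⟨N₀, hN₀⟩ := Metric.cauchySeq_iff.1 hlim.cauchySeq (ε / (2 * Real.pi)) (by positivity)
  have hlt : φ N₀ < φ (N₀ + 1) := hφ (Nat.lt_succ_self _)
  refine ⟨φ (N₀ + 1) - φ N₀, fun i => ⌊φ (N₀ + 1) * w i / (2 * Real.pi)⌋ -
    ⌊φ N₀ * w i / (2 * Real.pi)⌋, by omega, ?_⟩
  have key : (((φ (N₀ + 1) - φ N₀ : ℕ) : ℝ) • w - fun i => 2 * Real.pi *
      ((⌊φ (N₀ + 1) * w i / (2 * Real.pi)⌋ - ⌊φ N₀ * w i / (2 * Real.pi)⌋ : ℤ) : ℝ)) =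
      (2 * Real.pi) • (y (φ (N₀ + 1)) - y (φ N₀)) := by
    funext i
    simp only [hy, Pi.sub_apply, Pi.smul_apply, smul_eq_mul, Int.fract, Nat.cast_sub hlt.le,
      Int.cast_sub]
    field_simp
    ring
  rw [key, norm_smul, Real.norm_of_nonneg hpi.le, ← dist_eq_norm]
  have := hN₀ (N₀ + 1) (by omega) N₀ le_rfl
  rwa [lt_div_iff₀ hpi, mul_comm] at this

variable {E : Type*} [NormedAddCommGroup E] [NormedSpace ℂ E]
  {X : Type*} [TopologicalSpace X] [ChartedSpace E X] [IsManifold 𝓘(ℝ, E) ∞ X]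

/-- Unique continuation for periodic diffeomorphisms: if a smooth map of finite order is the
identity on a nonempty open subset of a connected manifold, then it is the identity. -/
theorem eq_id_of_iterate_eq_id [FiniteDimensional ℂ E] [T2Space X] [ConnectedSpace X]
    {g : X → X} (hg : ContMDiff 𝓘(ℝ, E) 𝓘(ℝ, E) ∞ g) {q : ℕ} (hq : 0 < q) (hgq : g^[q] = id)
    {U : Set X} (hU : IsOpen U) (hUne : U.Nonempty) (hgU : ∀ x ∈ U, g x = x) (x : X) :
    g x = x := by
  have : CompleteSpace E := FiniteDimensional.complete ℂ E
  set S : Set X := interior {x | g x = x} with hS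
  have hint : S ⊆ {x | g x = x} := interior_subset
  suffices hclopen : IsClopen S by
    have hne : S.Nonempty := hUne.mono (interior_maximal hgU hU)
    have := hclopen.eq_univ hne
    have hx : x ∈ S := this ▸ Set.mem_univ x
    exact hint hx
  refine ⟨?_, isOpen_interior⟩
  rw [← closure_subset_iff_isClosed]
  intro x hx
  have hfix : ∀ y ∈ closure S, g y = y := fun y hy =>
    closure_minimal (t := {y | g y = y}) interior_subset
      (isClosed_eq hg.continuous continuous_id) hy
  have hgx := hfix x hx
  set φ := chartAt E x with hφ
  have hxs : x ∈ φ.source := mem_chart_source E x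
  -- Averaging over the iterates of g. Invariance under g is a reindexing of the sum, so the values
  -- of the chart outside its source do no harm.
  set ψ : X → E := fun y => ∑ j ∈ Finset.range q, φ (g^[j] y) with hψ
  have hinv : ∀ y, ψ (g y) = ψ y := by
    intro y
    have h1 := Finset.sum_range_succ' (fun j => φ (g^[j] y)) q
    rw [Finset.sum_range_succ, hgq] at h1
    simp only [Function.iterate_succ, Function.comp_apply, Function.iterate_zero, id] at h1
    exact (add_right_cancel h1).symm
  have hit : ∀ j, ContMDiff 𝓘(ℝ, E) 𝓘(ℝ, E) ∞ (g^[j]) := by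
    intro j
    induction j with
    | zero => exact contMDiff_id
    | succ j ih => rw [Function.iterate_succ]; exact ih.comp hg
  have hitx : ∀ j, g^[j] x = x := fun j => Function.iterate_fixed hgx j
  have hψs : ContDiffAt ℝ ∞ (ψ ∘ φ.symm) (φ x) := by
    have h0 : (ψ ∘ φ.symm) = fun u => ∑ j ∈ Finset.range q, (φ ∘ g^[j] ∘ φ.symm) u := rfl
    rw [h0]
    refine ContDiffAt.sum fun j _ => ?_
    rw [← contMDiffAt_iff_contDiffAt]
    have h1 : ContMDiffAt 𝓘(ℝ, E) 𝓘(ℝ, E) ∞ φ.symm (φ x) :=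
      (contMDiffOn_chart_symm (I := 𝓘(ℝ, E)) (x := x)).contMDiffAt
        (φ.open_target.mem_nhds (φ.map_source hxs))
    have h2 : ContMDiffAt 𝓘(ℝ, E) 𝓘(ℝ, E) ∞ φ x :=
      (contMDiffOn_chart (I := 𝓘(ℝ, E)) (x := x)).contMDiffAt (φ.open_source.mem_nhds hxs)
    exact h2.comp_of_eq (((hit j).contMDiffAt).comp _ h1) (by simp [φ.left_inv hxs, hitx])
  have hS' : ∀ y ∈ S, ∀ j, g^[j] y = y := fun y hy j =>
    Function.iterate_fixed (hint hy) j
  -- On the interior of the fixed set every summand is the chart itself, so the derivative is q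
  -- there; continuity carries this to the boundary point x. Hence ψ is injective near x, and ψ ∘ g
  -- = ψ forces g = id there.
  have hder : fderiv ℝ (ψ ∘ φ.symm) (φ x) = (q : ℝ) • ContinuousLinearMap.id ℝ E := by
    have hcont : ContinuousAt (fderiv ℝ (ψ ∘ φ.symm)) (φ x) :=
      (hψs.fderiv_right (m := 0) (by simp)).continuousAt
    have hcl : φ x ∈ closure (φ.target ∩ φ.symm ⁻¹' S) :=
      mem_closure_chart_target_inter (E := E) hx
    have hval : ∀ u ∈ φ.target ∩ φ.symm ⁻¹' S,
        fderiv ℝ (ψ ∘ φ.symm) u = (q : ℝ) • ContinuousLinearMap.id ℝ E := by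
      intro u hu
      have hev : (ψ ∘ φ.symm) =ᶠ[𝓝 u] fun u => (q : ℝ) • u := by
        filter_upwards [(φ.isOpen_inter_preimage_symm isOpen_interior).mem_nhds hu] with w hw
        have : ∀ j ∈ Finset.range q, φ (g^[j] (φ.symm w)) = w := fun j _ => by
          rw [hS' _ hw.2, φ.right_inv hw.1]
        simp only [hψ, Function.comp_apply]
        rw [Finset.sum_congr rfl this]
        simp [Nat.cast_smul_eq_nsmul]
      rw [hev.fderiv_eq]
      exact ((hasFDerivAt_id u).const_smul (q : ℝ)).fderiv
    have hmem := hcont.continuousWithinAt.mem_closure (s := φ.target ∩ φ.symm ⁻¹' S)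
      (t := {(q : ℝ) • ContinuousLinearMap.id ℝ E}) hcl (fun u hu => hval u hu)
    simpa using hmem
  have hq' : (q : ℝ) ≠ 0 := by exact_mod_cast hq.ne'
  let e : E ≃L[ℝ] E := ContinuousLinearEquiv.smulLeft (Units.mk0 (q : ℝ) hq')
  have hstrict : HasStrictFDerivAt (ψ ∘ φ.symm) (e : E →L[ℝ] E) (φ x) := by
    have h1 := hψs.hasStrictFDerivAt (by simp)
    rw [hder] at h1
    exact h1
  set Φ := hstrict.toOpenPartialHomeomorph (ψ ∘ φ.symm) with hΦ
  have hΦs : Φ.source ∈ 𝓝 (φ x) :=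
    Φ.open_source.mem_nhds hstrict.mem_toOpenPartialHomeomorph_source
  have hW : φ.source ∩ φ ⁻¹' Φ.source ∈ 𝓝 x :=
    Filter.inter_mem (φ.open_source.mem_nhds hxs) ((φ.continuousAt hxs).preimage_mem_nhds hΦs)
  have hgW : g ⁻¹' (φ.source ∩ φ ⁻¹' Φ.source) ∈ 𝓝 x :=
    hg.continuous.continuousAt.preimage_mem_nhds (by rwa [hgx])
  rw [hS, mem_interior_iff_mem_nhds]
  filter_upwards [hW, hgW] with y hy hgy
  apply φ.injOn hgy.1 hy.1
  apply Φ.injOn hgy.2 hy.2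
  change (ψ ∘ φ.symm) _ = (ψ ∘ φ.symm) _
  simp only [Function.comp_apply, φ.left_inv hy.1, φ.left_inv hgy.1, hinv]

variable {k : ℕ} {κ : X → E [⋀^Fin 2]→L[ℝ] ℝ} {act : (Fin k → Circle) → X → X}
  {μ : X → (Fin k → ℝ) →L[ℝ] ℝ}

namespace IsHamiltonianTorusAction

/-- Small elements of the stabilizer lie in the exponential of its Lie algebra. -/
theorem exists_stabilizer_ball [FiniteDimensional ℂ E] [T2Space X]
    (h : IsHamiltonianTorusAction κ act μ) (x : X) :
    ∃ ε > 0, ∀ l : Fin k → ℝ, ‖l‖ < ε → act (torusExp l) x = x → orbitDeriv E act x l = 0 := by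
  set L := orbitDeriv E act x with hL
  let R := LinearMap.range (L : (Fin k → ℝ) →ₗ[ℝ] E)
  -- A linear section of the orbit derivative over its range is a slice transverse to the stabilizer
  -- algebra. Along it the orbit map has injective derivative at 0, so it does not return to x for
  -- small nonzero arguments.
  obtain ⟨S, hS⟩ : ∃ S : R →ₗ[ℝ] (Fin k → ℝ),
      (L : (Fin k → ℝ) →ₗ[ℝ] E).rangeRestrict ∘ₗ S = LinearMap.id :=
    (L : (Fin k → ℝ) →ₗ[ℝ] E).rangeRestrict.exists_rightInverse_of_surjective
      (LinearMap.range_rangeRestrict _)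
  have hLS : ∀ w : R, L (S w) = w := fun w => congrArg Subtype.val (LinearMap.congr_fun hS w)
  have : IsManifold 𝓘(ℝ, E) 1 X := .of_le (n := ∞) (by simp)
  have hmd := mdifferentiable_chart (I := 𝓘(ℝ, E)) x
  set A : E →L[ℝ] E := mfderiv 𝓘(ℝ, E) 𝓘(ℝ, E) (chartAt E x) x with hA
  have hAinj : Function.Injective A := hmd.mfderiv_injective (mem_chart_source E x)
  have h1 : HasMFDerivAt 𝓘(ℝ, E) 𝓘(ℝ, E) (chartAt E x) x A :=
    (hmd.mdifferentiableAt (mem_chart_source E x)).hasMFDerivAt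
  have h2 : HasFDerivAt (chartAt E x ∘ fun u => act (torusExp u) x) (A.comp L)
      (S.toContinuousLinearMap 0) := by
    rw [map_zero]
    exact (h1.comp_normed_of_eq (h.hasMFDerivAt_orbit x) (h.act_torusExp_zero x)).hasFDerivAt
  have h3 := h2.comp (0 : R) S.toContinuousLinearMap.hasFDerivAt
  have hinj : Function.Injective ((A.comp L).comp S.toContinuousLinearMap) := by
    intro w w' hw
    have : A (L (S w)) = A (L (S w')) := hw
    rw [hLS, hLS] at this
    exact Subtype.ext (hAinj this)
  have h4 := h3.eventually_ne (c := chartAt E x x) (by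
    obtain ⟨C, -, hC⟩ := LinearMap.exists_antilipschitzWith
      (((A.comp L).comp S.toContinuousLinearMap : R →L[ℝ] E) : R →ₗ[ℝ] E)
      (LinearMap.ker_eq_bot.2 hinj)
    exact ⟨C, hC⟩)
  rw [eventually_nhdsWithin_iff] at h4
  have hcont : Continuous (fun l : Fin k → ℝ => (L : (Fin k → ℝ) →ₗ[ℝ] E).rangeRestrict l) :=
    LinearMap.continuous_of_finiteDimensional _
  have h5 := (hcont.tendsto' 0 0 (map_zero _)).eventually h4
  obtain ⟨ε, hε, hball⟩ := Metric.eventually_nhds_iff.1 h5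
  refine ⟨ε, hε, fun l hl hfix => ?_⟩
  by_contra hne
  refine hball (by simpa using hl) (by
    intro h0
    exact hne (congrArg Subtype.val h0)) ?_
  set w : R := (L : (Fin k → ℝ) →ₗ[ℝ] E).rangeRestrict l with hw
  -- The component of l along the kernel already fixes x, so the slice component S w fixes x as
  -- well, which the slice excludes unless w = 0.
  have hker : L (l - S w) = 0 := by
    rw [map_sub, hLS]
    exact sub_self _
  have h6 := h.act_eq_self_of_orbitDeriv_eq_zero hker 1
  rw [one_smul] at h6
  have h7 : act (torusExp (S w)) x = x := by
    conv_lhs => rw [← h6, ← h.act_torusExp_add]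
    simpa using hfix
  change chartAt E x (act (torusExp (S w)) x) = _
  rw [h7]

/-- The Lie algebra of a stabilizer contains a nonzero integral vector unless it is zero. -/
theorem exists_int_orbitDeriv_eq_zero [FiniteDimensional ℂ E] [T2Space X]
    (h : IsHamiltonianTorusAction κ act μ) {x : X} {v : Fin k → ℝ} (hv0 : v ≠ 0)
    (hv : orbitDeriv E act x v = 0) :
    ∃ n : Fin k → ℤ, n ≠ 0 ∧ orbitDeriv E act x (fun i => (n i : ℝ)) = 0 := by
  obtain ⟨ε, hε, hball⟩ := h.exists_stabilizer_ball x
  have hvn : 0 < ‖v‖ := norm_pos_iff.2 hv0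
  -- With v normalized, its N-th multiple has norm N ≥ 1. The tolerance is at most 1, so n = 0 is
  -- ruled out.
  obtain ⟨N, n, hN, hn⟩ := exists_nat_mul_near_two_pi_int (‖v‖⁻¹ • v)
    (lt_min hε one_pos)
  have hNv : orbitDeriv E act x ((N : ℝ) • ‖v‖⁻¹ • v) = 0 := by simp [hv]
  have hfix : act (torusExp ((N : ℝ) • ‖v‖⁻¹ • v - fun i => 2 * Real.pi * (n i : ℝ))) x = x := by
    have h1 := h.act_eq_self_of_orbitDeriv_eq_zero hNv 1
    rw [one_smul] at h1
    have h2 : torusExp ((N : ℝ) • ‖v‖⁻¹ • v - fun i => 2 * Real.pi * (n i : ℝ)) =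
        torusExp ((N : ℝ) • ‖v‖⁻¹ • v) := by
      conv_rhs => rw [← sub_add_cancel ((N : ℝ) • ‖v‖⁻¹ • v) (fun i => 2 * Real.pi * (n i : ℝ))]
      rw [torusExp_add, torusExp_two_pi_int, mul_one]
    rw [h2, h1]
  have h3 := hball _ (hn.trans_le (min_le_left _ _)) hfix
  rw [map_sub, hNv, zero_sub, neg_eq_zero] at h3
  refine ⟨n, ?_, ?_⟩
  · rintro rfl
    have h4 := hn.trans_le (min_le_right _ _)
    have h5 : ((N : ℝ) • ‖v‖⁻¹ • v - fun i => 2 * Real.pi * (((0 : Fin k → ℤ) i : ℤ) : ℝ)) =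
        (N : ℝ) • ‖v‖⁻¹ • v := by
      funext i; simp
    rw [h5, norm_smul, norm_smul, norm_inv, norm_norm, inv_mul_cancel₀ hvn.ne', mul_one,
      Real.norm_natCast] at h4
    have : (1 : ℝ) ≤ N := by exact_mod_cast hN
    linarith
  · have h6 : (fun i => 2 * Real.pi * (n i : ℝ)) = (2 * Real.pi) • fun i => (n i : ℝ) := rfl
    rw [h6, map_smul, smul_eq_zero] at h3
    exact h3.resolve_left (by positivity)

/-- For rational r, the element exp(2πrn) has order dividing the denominator of r, and it fixes `U`
pointwise. Unique continuation for maps of finite order makes it act trivially, and density of ℚ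
gives all real times. -/
theorem orbitDeriv_int_eq_zero_of_isOpen [FiniteDimensional ℂ E] [T2Space X] [ConnectedSpace X]
    (h : IsHamiltonianTorusAction κ act μ) {U : Set X} (hU : IsOpen U) (hUne : U.Nonempty)
    {n : Fin k → ℤ} (hn : ∀ x ∈ U, orbitDeriv E act x (fun i => (n i : ℝ)) = 0) (x : X) :
    orbitDeriv E act x (fun i => (n i : ℝ)) = 0 := by
  have hrat : ∀ r : ℚ, act (torusExp ((2 * Real.pi * (r : ℝ)) • fun i => (n i : ℝ))) x = x := by
    intro r
    set v : Fin k → ℝ := (2 * Real.pi * (r : ℝ)) • fun i => (n i : ℝ) with hv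
    have hit : ∀ j : ℕ, (act (torusExp v))^[j] = act (torusExp ((j : ℝ) • v)) := by
      intro j
      induction j with
      | zero => funext y; simp [h.act_torusExp_zero]
      | succ j ih =>
        funext y
        rw [Function.iterate_succ_apply, ih, ← h.act_torusExp_add, Nat.cast_succ, add_smul,
          one_smul]
    refine eq_id_of_iterate_eq_id (h.contMDiff_act v) r.den_pos ?_ hU hUne
      (fun y hy => h.act_eq_self_of_orbitDeriv_eq_zero (hn y hy) _) x
    rw [hit]
    have h1 : (r.den : ℝ) • v = fun i => 2 * Real.pi * ((r.num * n i : ℤ) : ℝ) := by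
      funext i
      have h2 : (r.den : ℝ) * (r : ℝ) = r.num := by
        exact_mod_cast Rat.den_mul_eq_num r
      simp only [hv, Pi.smul_apply, smul_eq_mul, Int.cast_mul, ← h2]
      ring
    funext y
    rw [h1, torusExp_two_pi_int (fun i => r.num * n i), h.one_act, id]
  rw [h.orbitDeriv_eq_zero_iff]
  have hcont : Continuous fun s : ℝ =>
      act (torusExp ((2 * Real.pi * s) • fun i => (n i : ℝ))) x :=
    (h.contMDiff_orbit x).continuous.comp (by fun_prop)
  have hall := Rat.denseRange_cast.equalizer hcont continuous_const (funext hrat)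
  intro s
  have : act (torusExp ((2 * Real.pi * (s / (2 * Real.pi))) • fun i => (n i : ℝ))) x = x :=
    congrFun hall (s / (2 * Real.pi))
  rwa [mul_div_cancel₀ _ (by positivity)] at this

/-- For a locally effective torus action, the stabilizers are finite on a dense set. -/
theorem dense_injective_orbitDeriv [FiniteDimensional ℂ E] [T2Space X] [ConnectedSpace X]
    (h : IsHamiltonianTorusAction κ act μ)
    (heff : ∀ v : Fin k → ℝ, (∀ x : X, (fundamentalVectorField act v x : E) = 0) → v = 0) :
    Dense {x : X | Function.Injective (orbitDeriv E act x)} := by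
  have : LocallyCompactSpace X := Manifold.locallyCompact_of_finiteDimensional 𝓘(ℝ, E)
  -- Baire: each bad set is closed, since vanishing of the generator means being fixed by a
  -- one-parameter group, and has empty interior by local effectiveness.
  have hd : Dense (⋂ n : {n : Fin k → ℤ // n ≠ 0},
      {x : X | orbitDeriv E act x (fun i => (n.1 i : ℝ)) = 0}ᶜ) := by
    refine dense_iInter_of_isOpen (fun n => ?_) (fun n => ?_)
    · rw [isOpen_compl_iff]
      simp only [h.orbitDeriv_eq_zero_iff]
      rw [Set.ofPred_forall]
      exact isClosed_iInter fun s => isClosed_eq (h.contMDiff_act _).continuous continuous_id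
    · rw [← interior_eq_empty_iff_dense_compl, Set.eq_empty_iff_forall_notMem]
      intro x hx
      refine n.2 ?_
      have hint := interior_subset (s := {x : X | orbitDeriv E act x (fun i => (n.1 i : ℝ)) = 0})
      have h0 := heff (fun i => (n.1 i : ℝ)) fun y => by
        rw [h.fundamentalVectorField_eq]
        exact h.orbitDeriv_int_eq_zero_of_isOpen isOpen_interior ⟨x, hx⟩
          (fun z hz => hint hz) y
      funext i
      simpa using congrFun h0 i
  refine hd.mono fun x hx => ?_
  rw [Set.mem_ofPred_eq, injective_iff_map_eq_zero]
  intro v hv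
  by_contra hv0
  obtain ⟨n, hn0, hn⟩ := h.exists_int_orbitDeriv_eq_zero hv0 hv
  exact Set.mem_iInter.1 hx ⟨n, hn0⟩ hn

end IsHamiltonianTorusAction

end TorusDensity

/-! ### Linear algebra of a positive 2-form. -/

section LinearAlgebra

theorem ContinuousAlternatingMap.map_pair_swap {E : Type*} [NormedAddCommGroup E]
    [NormedSpace ℝ E] (η : E [⋀^Fin 2]→L[ℝ] ℝ) (v w : E) : η ![v, w] = -η ![w, v] := by
  have h := η.toAlternatingMap.map_swap ![w, v] (i := 0) (j := 1) (by simp)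
  have h1 : (![w, v] ∘ Equiv.swap (0 : Fin 2) 1) = ![v, w] := by
    funext i
    fin_cases i <;> simp
  rw [h1] at h
  exact h

variable {E : Type*} [NormedAddCommGroup E] [NormedSpace ℂ E] [FiniteDimensional ℂ E]

/-- The linear map `v ↦ ι_v η` from vectors to covectors defined by a 2-form. -/
noncomputable def contraction (η : E [⋀^Fin 2]→L[ℝ] ℝ) : E →L[ℝ] E →L[ℝ] ℝ :=
  (LinearMap.mk₂ ℝ (fun v w : E => η ![v, w])
    (fun v v' w => η.toAlternatingMap.map_vecCons_add ![w] v v')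
    (fun c v w => η.toAlternatingMap.map_vecCons_smul ![w] c v)
    (fun v w w' => by
      rw [η.map_pair_swap v, η.map_pair_swap v, η.map_pair_swap v]
      have := η.toAlternatingMap.map_vecCons_add ![v] w w'
      simp only [ContinuousAlternatingMap.coe_toAlternatingMap] at this
      rw [this, neg_add])
    (fun c v w => by
      rw [η.map_pair_swap v, η.map_pair_swap v]
      have := η.toAlternatingMap.map_vecCons_smul ![v] c w
      simp only [ContinuousAlternatingMap.coe_toAlternatingMap] at this
      rw [this, smul_neg])).toContinuousBilinearMap

theorem contraction_apply (η : E [⋀^Fin 2]→L[ℝ] ℝ) (v w : E) :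
    contraction η v w = η ![v, w] := rfl

theorem ContinuousLinearMap.bijective_of_injective_dual {F : Type*} [NormedAddCommGroup F]
    [NormedSpace ℝ F] [FiniteDimensional ℝ F] {K : F →L[ℝ] F →L[ℝ] ℝ}
    (hK : Function.Injective K) : Function.Bijective K := by
  have hdim : Module.finrank ℝ F = Module.finrank ℝ (F →L[ℝ] ℝ) := by
    rw [← LinearEquiv.finrank_eq (LinearMap.toContinuousLinearMap (𝕜 := ℝ) (E := F) (F' := ℝ))]
    exact (Subspace.dual_finrank_eq (K := ℝ) (V := F)).symm
  exact ⟨hK, (LinearMap.injective_iff_surjective_of_finrank_eq_finrank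
    (f := (K : F →ₗ[ℝ] F →L[ℝ] ℝ)) hdim).1 hK⟩

variable {η : E [⋀^Fin 2]→L[ℝ] ℝ}

theorem contraction_injective (hη : ∀ v : E, v ≠ 0 → 0 < η ![v, Complex.I • v]) :
    Function.Injective (contraction η) := by
  rw [injective_iff_map_eq_zero]
  intro v hv
  by_contra h
  have := hη v h
  rw [← contraction_apply, hv] at this
  simp at this

/-- Horizontal lifts exist for complex-linear surjections, as complex subspaces are symplectic. -/
theorem exists_contraction_horizontal_lift (hη : ∀ v : E, v ≠ 0 → 0 < η ![v, Complex.I • v])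
    {E' : Type*} [NormedAddCommGroup E'] [NormedSpace ℂ E'] {A : E →L[ℂ] E'}
    (hA : Function.Surjective A) (u : E') :
    ∃ w, A w = u ∧ ∀ v, A v = 0 → η ![w, v] = 0 := by
  obtain ⟨w₀, hw₀⟩ := hA u
  let K : Submodule ℝ E := LinearMap.ker (A.restrictScalars ℝ : E →ₗ[ℝ] E')
  have hmem : ∀ {v : E}, v ∈ K ↔ A v = 0 := Iff.rfl
  let R : (E →L[ℝ] ℝ) →L[ℝ] (K →L[ℝ] ℝ) := K.subtypeL.precomp ℝ
  let B : K →L[ℝ] K →L[ℝ] ℝ := R.comp ((contraction η).comp K.subtypeL)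
  have hB : ∀ z v : K, B z v = η ![(z : E), (v : E)] := fun z v => rfl
  -- The kernel of the complex-linear A contains Iz along with z, so positivity makes the restricted
  -- form nondegenerate; w₀ can then be corrected by a kernel vector.
  have hinj : Function.Injective B := by
    rw [injective_iff_map_eq_zero]
    intro z hz
    by_contra h
    have hIz : Complex.I • (z : E) ∈ K := by
      rw [hmem, map_smul, hmem.1 z.2, smul_zero]
    have h1 := hη z (fun h0 => h (Subtype.ext h0))
    have h2 := hB z ⟨_, hIz⟩
    rw [hz] at h2
    exact h1.ne h2
  obtain ⟨z, hz⟩ := (ContinuousLinearMap.bijective_of_injective_dual hinj).2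
    (R (contraction η w₀))
  refine ⟨w₀ - z, by rw [map_sub, hw₀, hmem.1 z.2, sub_zero], fun v hv => ?_⟩
  have h1 : η ![(z : E), v] = η ![w₀, v] := DFunLike.congr_fun hz (⟨v, hmem.2 hv⟩ : K)
  rw [← contraction_apply, map_sub, sub_apply, contraction_apply,
    contraction_apply, h1, sub_self]

/-- Isotropic real subspaces are totally real. -/
theorem LinearIndependent.complex_of_isotropic
    (hη : ∀ v : E, v ≠ 0 → 0 < η ![v, Complex.I • v]) {ι : Type*} [Fintype ι] {v : ι → E}
    (hv : LinearIndependent ℝ v) (hiso : ∀ i j, η ![v i, v j] = 0) : LinearIndependent ℂ v := by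
  rw [Fintype.linearIndependent_iff] at hv ⊢
  intro c hc
  set A := ∑ i, (c i).re • v i with hA
  set B := ∑ i, (c i).im • v i with hB
  have hAB : A + Complex.I • B = 0 := by
    rw [← hc, hA, hB, Finset.smul_sum, ← Finset.sum_add_distrib]
    refine Finset.sum_congr rfl fun i _ => ?_
    conv_rhs => rw [← Complex.re_add_im (c i)]
    rw [add_smul, mul_comm, mul_smul, Complex.coe_smul, Complex.coe_smul]
  have hBA : contraction η B A = 0 := by
    rw [hA, hB]
    simp only [map_sum, map_smul, sum_apply, smul_apply,
      contraction_apply, hiso, smul_zero, Finset.sum_const_zero]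
  -- Here A = -IB, so isotropy gives 0 = η(B, A) = -η(B, IB).
  have hB0 : B = 0 := by
    by_contra h
    have h1 := hη B h
    rw [← contraction_apply, eq_neg_of_add_eq_zero_right hAB, map_neg, hBA] at h1
    simp at h1
  have hA0 : A = 0 := by simpa [hB0] using hAB
  intro i
  exact Complex.ext (hv _ hA0 i) (hv _ hB0 i)

/-- A nonzero top-degree form does not vanish on an extension of any independent family. -/
theorem exists_append_ne_zero {k m : ℕ} (hE : Module.finrank ℂ E = k + m)
    {Ω : E [⋀^Fin (k + m)]→L[ℂ] ℂ} (hΩ : Ω ≠ 0) {v : Fin k → E} (hv : LinearIndependent ℂ v) :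
    ∃ w : Fin m → E, Ω (Fin.append v w) ≠ 0 := by
  let S := Submodule.span ℂ (Set.range v)
  have hS : Module.finrank ℂ S = k := by
    simpa using finrank_span_eq_card hv
  have hq : Module.finrank ℂ (E ⧸ S) = m := by
    have := S.finrank_quotient_add_finrank
    omega
  let c := Module.finBasisOfFinrankEq ℂ (E ⧸ S) hq
  choose w hw using fun j => S.mkQ_surjective (c j)
  have hc : LinearIndependent ℂ (Submodule.Quotient.mk (p := S) ∘ w) := by
    have : Submodule.Quotient.mk (p := S) ∘ w = c := funext hw
    rw [this]
    exact c.linearIndependent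
  have hli := (linearIndependent_span hv).sumElim_of_quotient w hc
  have hli' : LinearIndependent ℂ (Fin.append v w) := by
    have h1 := hli.comp _ finSumFinEquiv.symm.injective
    have h2 : Fin.append v w = Sum.elim v w ∘ finSumFinEquiv.symm := by
      funext i
      refine Fin.addCases (fun i => ?_) (fun j => ?_) i <;> simp
    rw [h2]
    exact h1
  refine ⟨w, ?_⟩
  let e := Module.Basis.mk hli' (hli'.span_eq_top_of_card_eq_finrank' (by simp [hE])).ge
  have h2 := (AlternatingMap.map_basis_ne_zero_iff e Ω.toAlternatingMap).2 (fun h0 => hΩ (by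
    ext x
    exact DFunLike.congr_fun h0 x))
  rw [Module.Basis.coe_mk] at h2
  exact h2

end LinearAlgebra

/-! ### Determinants and surjectivity. -/

section Wedge

variable {E : Type*} [NormedAddCommGroup E] [NormedSpace ℂ E]

theorem linearIndependent_of_wedgeApply_ne_zero {m : ℕ} {α : Fin m → E →L[ℂ] ℂ} {w : Fin m → E}
    (h : wedgeApply α w ≠ 0) : LinearIndependent ℂ α := by
  rw [Fintype.linearIndependent_iff]
  intro c hc
  have hli := Matrix.linearIndependent_rows_of_det_ne_zero h
  rw [Fintype.linearIndependent_iff] at hli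
  refine hli c ?_
  funext j
  have := DFunLike.congr_fun hc (w j)
  simpa [Matrix.row] using this

/-- A relation among the vectors A(w_j) would be a relation among the columns of the determinant, so
these m vectors form a basis of the target. -/
theorem surjective_of_wedgeApply_comp_ne_zero {m : ℕ} {E' : Type*} [NormedAddCommGroup E']
    [NormedSpace ℂ E'] [FiniteDimensional ℂ E'] (hE' : Module.finrank ℂ E' = m)
    {A : E →L[ℂ] E'} {β : Fin m → E' →L[ℂ] ℂ} {w : Fin m → E}
    (h : wedgeApply (fun j => (β j).comp A) w ≠ 0) : Function.Surjective A := by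
  have hli : LinearIndependent ℂ (A ∘ w) := by
    rw [Fintype.linearIndependent_iff]
    intro c hc
    have hcol := Matrix.linearIndependent_cols_of_det_ne_zero h
    rw [Fintype.linearIndependent_iff] at hcol
    refine hcol c ?_
    funext i
    have := congrArg (β i) hc
    simpa [Matrix.col] using this
  have hspan := hli.span_eq_top_of_card_eq_finrank' (by simp [hE'])
  have hle : Submodule.span ℂ (Set.range (A ∘ w)) ≤ LinearMap.range (A : E →ₗ[ℂ] E') :=
    Submodule.span_le.2 (by
      rintro _ ⟨j, rfl⟩
      exact ⟨w j, rfl⟩)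
  rw [hspan, top_le_iff] at hle
  exact LinearMap.range_eq_top.1 hle

/-- A proper range would lie in the kernel of a nonzero functional, whose coordinates are a relation
among the components. -/
theorem surjective_pi_of_independent {V : Type*} [AddCommGroup V] [Module ℝ V] {n : ℕ}
    (L : V →ₗ[ℝ] (Fin n → ℝ)) (h : ∀ a : Fin n → ℝ, (∀ v, ∑ i, a i * L v i = 0) → a = 0) :
    Function.Surjective L := by
  rw [← LinearMap.range_eq_top]
  by_contra hne
  obtain ⟨φ, hφ, hle⟩ := Submodule.exists_le_ker_of_lt_top _ (lt_top_iff_ne_top.2 hne)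
  refine hφ ?_
  have ha := h (fun i => φ (Pi.single i 1)) fun v => by
    have h1 : φ (L v) = 0 := hle ⟨v, rfl⟩
    rw [LinearMap.pi_apply_eq_sum_univ φ (L v)] at h1
    rw [← h1]
    refine Finset.sum_congr rfl fun i _ => ?_
    rw [smul_eq_mul, mul_comm]
    congr 2
    funext j
    simp [Pi.single_apply, eq_comm]
  refine LinearMap.pi_ext' fun i => LinearMap.ext_ring ?_
  simpa using congrFun ha i

/-- If S is a right inverse of L₀, then L ∘ S stays invertible for L near L₀, because units are
open. -/
theorem isOpen_surjective_clm {F : Type*} [NormedAddCommGroup F] [NormedSpace ℝ F] {n : ℕ} :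
    IsOpen {L : F →L[ℝ] (Fin n → ℝ) | Function.Surjective L} := by
  rw [isOpen_iff_mem_nhds]
  intro L₀ hL₀
  obtain ⟨S, hS⟩ := (L₀ : F →ₗ[ℝ] (Fin n → ℝ)).exists_rightInverse_of_surjective
    (LinearMap.range_eq_top.2 hL₀)
  let S' : (Fin n → ℝ) →L[ℝ] F := S.toContinuousLinearMap
  have hcont : Continuous fun L : F →L[ℝ] (Fin n → ℝ) => L.comp S' := by fun_prop
  have h1 : IsUnit (L₀.comp S') := by
    have : L₀.comp S' = 1 := by
      ext1 v
      exact LinearMap.congr_fun hS v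
    rw [this]
    exact isUnit_one
  filter_upwards [hcont.continuousAt.preimage_mem_nhds (Units.isOpen.mem_nhds h1)] with L hL
  intro y
  obtain ⟨T, hT⟩ := (show IsUnit (L.comp S') from hL).exists_right_inv
  exact ⟨S' (T y), DFunLike.congr_fun hT y⟩

end Wedge

/-! ### Openness of the regular locus. -/

section Regular

variable {E : Type*} [NormedAddCommGroup E] [NormedSpace ℂ E] {X : Type*} [TopologicalSpace X]
  [ChartedSpace E X]

theorem isOpen_regularLocus [IsManifold 𝓘(ℝ, E) ∞ X] {n : ℕ} {ρ : X → Fin n → ℝ} {U : Set X}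
    (hU : IsOpen U) (hρ : ContMDiffOn 𝓘(ℝ, E) 𝓘(ℝ, Fin n → ℝ) ∞ ρ U) :
    IsOpen (regularLocus (E := E) ρ U) := by
  rw [isOpen_iff_mem_nhds]
  intro x hx
  set φ := chartAt E x with hφ
  have hsurj : ∀ u ∈ φ.target ∩ φ.symm ⁻¹' U,
      (Function.Surjective (realMFDeriv E (Fin n → ℝ) ρ (φ.symm u)) ↔
        Function.Surjective (fderiv ℝ (ρ ∘ φ.symm) u)) := by
    intro u hu
    rw [fderiv_comp_chart_symm x hu.1
      ((hρ.contMDiffAt (hU.mem_nhds hu.2)).mdifferentiableAt (by simp))]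
    exact ((bijective_realMFDeriv_chart_symm x hu.1).2.of_comp_iff _).symm
  have hxs : x ∈ φ.source := mem_chart_source E x
  have hxt : φ x ∈ φ.target := φ.map_source hxs
  have hxx : φ.symm (φ x) = x := φ.left_inv hxs
  have hmem : φ x ∈ φ.target ∩ φ.symm ⁻¹' U := ⟨hxt, by simpa [hxx] using hx.1⟩
  have hnhds : φ.target ∩ φ.symm ⁻¹' U ∈ 𝓝 (φ x) :=
    (φ.isOpen_inter_preimage_symm hU).mem_nhds hmem
  have hc := (hρ.continuousOn_fderiv_comp_chart_symm hU x).continuousAt hnhds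
  have h0 : Function.Surjective (fderiv ℝ (ρ ∘ φ.symm) (φ x)) := by
    rw [← hsurj _ hmem, hxx]
    exact hx.2
  have hev := hc.preimage_mem_nhds (isOpen_surjective_clm.mem_nhds h0)
  filter_upwards [φ.open_source.mem_nhds hxs, hU.mem_nhds hx.1,
    (φ.continuousAt hxs).preimage_mem_nhds hev] with y hys hyU hy
  refine ⟨hyU, ?_⟩
  have h1 := (hsurj (φ y) ⟨φ.map_source hys, by simpa [φ.left_inv hys] using hyU⟩).2 hy
  rwa [φ.left_inv hys] at h1

end Regular

/-! ### Hamiltonian vectors and continuity of the Poisson bracket. -/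

section Hamiltonian

variable {E : Type*} [NormedAddCommGroup E] [NormedSpace ℂ E] [FiniteDimensional ℂ E]
  {X : Type*} [TopologicalSpace X] [ChartedSpace E X] {κ : X → E [⋀^Fin 2]→L[ℝ] ℝ}

theorem isHamiltonianVector_iff {h : X → ℝ} {x : X} {v : E} :
    IsHamiltonianVector κ h x v ↔
      contraction (κ x) v = realMFDeriv E ℝ h x :=
  ⟨fun hv => ContinuousLinearMap.ext hv, fun hv w => DFunLike.congr_fun hv w⟩

theorem IsKahlerForm.contraction_bijective (hκ : IsKahlerForm κ) (x : X) :
    Function.Bijective (contraction (κ x)) :=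
  ContinuousLinearMap.bijective_of_injective_dual (contraction_injective (hκ.pos x))

theorem IsKahlerForm.exists_isHamiltonianVector (hκ : IsKahlerForm κ) (h : X → ℝ) (x : X) :
    ∃ v : E, IsHamiltonianVector κ h x v := by
  obtain ⟨v, hv⟩ := (hκ.contraction_bijective x).2
    (realMFDeriv E ℝ h x)
  exact ⟨v, isHamiltonianVector_iff.2 hv⟩

theorem IsKahlerForm.isHamiltonianVector_unique (hκ : IsKahlerForm κ) {h : X → ℝ} {x : X}
    {v w : E} (hv : IsHamiltonianVector κ h x v) (hw : IsHamiltonianVector κ h x w) : v = w :=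
  (hκ.contraction_bijective x).1
    ((isHamiltonianVector_iff.1 hv).trans (isHamiltonianVector_iff.1 hw).symm)

theorem contraction_formInChart (x₀ : X) (u v w : E) :
    contraction (formInChart ℝ κ x₀ u) v w =
      contraction (κ ((chartAt E x₀).symm u))
        (realMFDeriv E E (chartAt E x₀).symm u v)
        (realMFDeriv E E (chartAt E x₀).symm u w) := by
  change κ ((chartAt E x₀).symm u) (realMFDeriv E E (chartAt E x₀).symm u ∘ ![v, w]) = _
  rw [contraction_apply]
  congr 1
  funext i
  fin_cases i <;> rfl

theorem IsKahlerForm.continuousOn_contraction (hκ : IsKahlerForm κ) (x₀ : X) :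
    ContinuousOn (fun u => contraction (formInChart ℝ κ x₀ u)) (chartAt E x₀).target := by
  rw [continuousOn_clm_apply]
  intro v
  rw [continuousOn_clm_apply]
  intro w
  have h := (hκ.smooth x₀).continuousOn
  exact (ContinuousAlternatingMap.apply ℝ E ℝ ![v, w]).continuous.comp_continuousOn h

/-- Being the Hamiltonian vector of a function can be read off in a chart. -/
theorem isHamiltonianVector_chart_iff [IsManifold 𝓘(ℝ, E) ∞ X] {h : X → ℝ} (x₀ : X) {u : E}
    (hu : u ∈ (chartAt E x₀).target)
    (hh : MDifferentiableAt 𝓘(ℝ, E) 𝓘(ℝ, ℝ) h ((chartAt E x₀).symm u)) (v : E) :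
    IsHamiltonianVector κ h ((chartAt E x₀).symm u)
        (realMFDeriv E E (chartAt E x₀).symm u v) ↔
      contraction (formInChart ℝ κ x₀ u) v = fderiv ℝ (h ∘ (chartAt E x₀).symm) u := by
  rw [isHamiltonianVector_iff, fderiv_comp_chart_symm x₀ hu hh]
  constructor
  · intro hv
    ext w
    rw [contraction_formInChart, hv]
    rfl
  · intro hv
    ext w
    obtain ⟨w, rfl⟩ := (bijective_realMFDeriv_chart_symm x₀ hu).2 w
    rw [← contraction_formInChart, hv]
    rfl

theorem IsKahlerForm.formInChart_contraction_injective [IsManifold 𝓘(ℝ, E) ∞ X]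
    (hκ : IsKahlerForm κ) (x₀ : X) {u : E} (hu : u ∈ (chartAt E x₀).target) :
    Function.Injective (contraction (formInChart ℝ κ x₀ u)) := by
  rw [injective_iff_map_eq_zero]
  intro v hv
  have hA := bijective_realMFDeriv_chart_symm x₀ hu
  apply (injective_iff_map_eq_zero _).1 hA.1
  apply (injective_iff_map_eq_zero _).1 (hκ.contraction_bijective ((chartAt E x₀).symm u)).1
  ext w
  obtain ⟨w, rfl⟩ := hA.2 w
  rw [← contraction_formInChart, hv]
  rfl

/-- The Poisson bracket is continuous, so it vanishes on the closure of its zeros. -/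
theorem IsKahlerForm.poissonCommuteAt_of_mem_closure [IsManifold 𝓘(ℝ, E) ∞ X]
    (hκ : IsKahlerForm κ) {U S : Set X} (hU : IsOpen U) {g h : X → ℝ}
    (hg : ContMDiffOn 𝓘(ℝ, E) 𝓘(ℝ, ℝ) ∞ g U) (hh : ContMDiffOn 𝓘(ℝ, E) 𝓘(ℝ, ℝ) ∞ h U)
    (hSU : S ⊆ U) (hS : ∀ x ∈ S, PoissonCommuteAt κ g h x) {x : X} (hxU : x ∈ U)
    (hx : x ∈ closure S) : PoissonCommuteAt κ g h x := by
  have hgd : ∀ y ∈ U, MDifferentiableAt 𝓘(ℝ, E) 𝓘(ℝ, ℝ) g y := fun y hy =>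
    (hg.contMDiffAt (hU.mem_nhds hy)).mdifferentiableAt (by simp)
  have hhd : ∀ y ∈ U, MDifferentiableAt 𝓘(ℝ, E) 𝓘(ℝ, ℝ) h y := fun y hy =>
    (hh.contMDiffAt (hU.mem_nhds hy)).mdifferentiableAt (by simp)
  have : CompleteSpace E := FiniteDimensional.complete ℂ E
  set φ := chartAt E x with hφ
  set K : E → E →L[ℝ] E →L[ℝ] ℝ := fun u => contraction (formInChart ℝ κ x u) with hK
  have hKbij : ∀ u ∈ φ.target, Function.Bijective (K u) := fun u hu =>
    ContinuousLinearMap.bijective_of_injective_dual (hκ.formInChart_contraction_injective x hu)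
  have hinv : ∀ u ∈ φ.target, ∃ e : E ≃L[ℝ] (E →L[ℝ] ℝ), (e : E →L[ℝ] E →L[ℝ] ℝ) = K u :=
    fun u hu => ⟨(LinearEquiv.ofBijective (K u : E →ₗ[ℝ] E →L[ℝ] ℝ)
      (hKbij u hu)).toContinuousLinearEquiv, by ext; rfl⟩
  -- The bracket in coordinates: if K z₁ = dg and K z₂ = dh, then dg(K⁻¹ dh) = κ(z₁, z₂). It is
  -- continuous because inversion of operators is continuous at invertible ones.
  set G : E → ℝ := fun u =>
    fderiv ℝ (g ∘ φ.symm) u ((K u).inverse (fderiv ℝ (h ∘ φ.symm) u)) with hG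
  have hxs : x ∈ φ.source := mem_chart_source E x
  have hxt : φ x ∈ φ.target := φ.map_source hxs
  have hxx : φ.symm (φ x) = x := φ.left_inv hxs
  have hnhds : φ.target ∩ φ.symm ⁻¹' U ∈ 𝓝 (φ x) :=
    (φ.isOpen_inter_preimage_symm hU).mem_nhds ⟨hxt, by simpa [hxx] using hxU⟩
  have hGc : ContinuousAt G (φ x) := by
    have h1 := (hg.continuousOn_fderiv_comp_chart_symm hU x).continuousAt hnhds
    have h2 := (hh.continuousOn_fderiv_comp_chart_symm hU x).continuousAt hnhds
    have h3 := (hκ.continuousOn_contraction x).continuousAt (φ.open_target.mem_nhds hxt)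
    obtain ⟨e, he⟩ := hinv _ hxt
    have h4 : ContinuousAt ContinuousLinearMap.inverse (K (φ x)) := by
      rw [← he]
      exact (contDiffAt_map_inverse (n := 0) e).continuousAt
    have h5 : ContinuousAt (fun u => (K u).inverse) (φ x) :=
      ContinuousAt.comp (g := ContinuousLinearMap.inverse) h4 h3
    exact h1.clm_apply (h5.clm_apply h2)
  have hinvK : ∀ u ∈ φ.target, ∀ z, (K u).inverse (K u z) = z := by
    intro u hu z
    obtain ⟨e, he⟩ := hinv u hu
    rw [← he, ContinuousLinearMap.inverse_equiv]
    simp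
  have hGS : ∀ u ∈ φ.target ∩ φ.symm ⁻¹' S, G u = 0 := by
    intro u hu
    obtain ⟨z₁, hz₁⟩ := (hKbij u hu.1).2 (fderiv ℝ (g ∘ φ.symm) u)
    obtain ⟨z₂, hz₂⟩ := (hKbij u hu.1).2 (fderiv ℝ (h ∘ φ.symm) u)
    have h1 := (isHamiltonianVector_chart_iff x hu.1 (hgd _ (hSU hu.2)) z₁).2 hz₁
    have h2 := (isHamiltonianVector_chart_iff x hu.1 (hhd _ (hSU hu.2)) z₂).2 hz₂
    have h3 := hS _ hu.2 _ _ h1 h2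
    rw [← contraction_apply, ← contraction_formInChart] at h3
    simp only [hG]
    rw [← hz₂, hinvK u hu.1, ← hz₁]
    exact h3
  have hGx : G (φ x) = 0 := by
    have := hGc.continuousWithinAt.mem_closure (t := {0})
      (mem_closure_chart_target_inter (E := E) hx) (fun u hu => hGS u hu)
    simpa using this
  intro v w hv hw
  rw [← hxx] at hv hw ⊢
  have hUx : φ.symm (φ x) ∈ U := by rwa [hxx]
  obtain ⟨z₁, rfl⟩ := (bijective_realMFDeriv_chart_symm x hxt).2 v
  obtain ⟨z₂, rfl⟩ := (bijective_realMFDeriv_chart_symm x hxt).2 w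
  have h1 := (isHamiltonianVector_chart_iff x hxt (hgd _ hUx) z₁).1 hv
  have h2 := (isHamiltonianVector_chart_iff x hxt (hhd _ hUx) z₂).1 hw
  rw [← contraction_apply, ← contraction_formInChart, h1]
  simp only [hG] at hGx
  rw [← h2, hinvK _ hxt] at hGx
  exact hGx

end Hamiltonian

/-! ### The differential of the modulus. -/

section NormDerivative

/-- Written as d|z| = |z| Re(dz/z), so that the real part of a logarithmic differential appears. -/
theorem hasFDerivAt_complex_norm {z : ℂ} (hz : z ≠ 0) :
    HasFDerivAt (fun w : ℂ => ‖w‖)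
      (‖z‖ • Complex.reCLM.comp ((z⁻¹ • ContinuousLinearMap.id ℂ ℂ).restrictScalars ℝ)) z := by
  have h1 := ((hasFDerivAt_id (𝕜 := ℝ) z).norm_sq).sqrt (by simpa using hz)
  simp only [id, Real.sqrt_sq (norm_nonneg _)] at h1
  refine h1.congr_fderiv ?_
  have hn : ‖z‖ ≠ 0 := by simpa using hz
  ext
  simp [Complex.inner, Complex.inv_re, Complex.inv_im, Complex.normSq_eq_norm_sq]
  field_simp
  ring

variable {E : Type*} [NormedAddCommGroup E] [NormedSpace ℂ E]
  {X : Type*} [TopologicalSpace X] [ChartedSpace E X]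

theorem realMFDeriv_norm_apply {g : X → ℂ} {x : X} (hg : MDifferentiableAt 𝓘(ℂ, E) 𝓘(ℂ, ℂ) g x)
    (h0 : g x ≠ 0) (v : E) :
    realMFDeriv E ℝ (fun y => ‖g y‖) x v = ‖g x‖ * (dlog g x v).re := by
  have h1 := (hasFDerivAt_complex_norm h0).hasMFDerivAt.comp_normed_of_eq
    hg.hasMFDerivAt.real_of_complex rfl
  have h2 := h1.mfderiv
  exact DFunLike.congr_fun h2 v

end NormDerivative

/-! ### Global extension of germs. -/

section Extension

variable {E : Type*} [NormedAddCommGroup E] [NormedSpace ℂ E] [FiniteDimensional ℂ E]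
  {X : Type*} [TopologicalSpace X] [ChartedSpace E X] [T2Space X] [IsManifold 𝓘(ℝ, E) ∞ X]

/-- A function smooth near a point has the same germ there as a globally smooth function. -/
theorem ContMDiffOn.exists_contMDiff_eventuallyEq {h : X → ℝ} {U : Set X} (hU : IsOpen U)
    (hh : ContMDiffOn 𝓘(ℝ, E) 𝓘(ℝ, ℝ) ∞ h U) {x : X} (hx : x ∈ U) :
    ∃ h' : X → ℝ, ContMDiff 𝓘(ℝ, E) 𝓘(ℝ, ℝ) ∞ h' ∧ h' =ᶠ[𝓝 x] h := by
  obtain ⟨f, -, hf⟩ := (SmoothBumpFunction.nhds_basis_tsupport (I := 𝓘(ℝ, E)) x).mem_iff.1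
    (hU.mem_nhds hx)
  refine ⟨fun y => f y * h y, ?_, ?_⟩
  · refine contMDiff_of_tsupport fun y hy => ?_
    have hy' : y ∈ U := hf (tsupport_mul_subset_left hy)
    exact (f.contMDiff.contMDiffAt).mul (hh.contMDiffAt (hU.mem_nhds hy'))
  · filter_upwards [f.eventuallyEq_one] with y hy
    simp [hy]

end Extension

/-! ### The fibration at one point: submersion, isotropy, phase. -/

section PointwiseFibration

variable {E : Type*} [NormedAddCommGroup E] [NormedSpace ℂ E] [FiniteDimensional ℂ E]
  {η : E [⋀^Fin 2]→L[ℝ] ℝ} {k m n : ℕ}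

/-- Covectors dual to an independent family `V`, together with the real parts of independent complex
covectors which annihilate `V`, are independent. -/
theorem surjective_of_dual_of_re (hη : ∀ v : E, v ≠ 0 → 0 < η ![v, Complex.I • v])
    {V : Fin k → E} (hV : LinearIndependent ℝ V) {α : Fin m → E →L[ℂ] ℂ}
    (hα : LinearIndependent ℂ α) (hαV : ∀ j i, α j (V i) = 0) {c : Fin m → ℝ}
    (hc : ∀ j, c j ≠ 0) {L : E →L[ℝ] (Fin (k + m) → ℝ)}
    (hL₁ : ∀ i v, L v (Fin.castAdd m i) = η ![V i, v])
    (hL₂ : ∀ j v, L v (Fin.natAdd k j) = c j * (α j v).re) : Function.Surjective L := by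
  refine surjective_pi_of_independent (L : E →ₗ[ℝ] (Fin (k + m) → ℝ)) fun a ha => ?_
  set W := ∑ i, a (Fin.castAdd m i) • V i with hW
  set β : E →L[ℂ] ℂ := ∑ j, ((a (Fin.natAdd k j) * c j : ℝ) : ℂ) • α j with hβ
  have hsum : ∀ v, contraction η W v + (β v).re = 0 := by
    intro v
    rw [← ha v, Fin.sum_univ_add]
    congr 1
    · simp [hW, hL₁, contraction_apply]
    · simp [hβ, hL₂, mul_assoc]
  -- W is a real combination of the V_i, which β annihilates; complex linearity then gives IW, the
  -- vector on which the other term is positive.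
  have hβW : β (Complex.I • W) = 0 := by
    have h1 : ∀ j, α j W = 0 := fun j => by
      have : α j W = (α j).restrictScalars ℝ W := rfl
      rw [this, hW, map_sum]
      simp [hαV]
    rw [map_smul, hβ]
    simp [h1]
  have hW0 : W = 0 := by
    by_contra h
    have h1 := hsum (Complex.I • W)
    rw [hβW, Complex.zero_re, add_zero] at h1
    exact (hη W h).ne' h1
  have hβ0 : β = 0 := by
    have h1 : ∀ v, (β v).re = 0 := fun v => by simpa [hW0] using hsum v
    ext v
    refine Complex.ext (h1 v) ?_
    have := h1 (Complex.I • v)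
    simpa using this
  rw [Fintype.linearIndependent_iff] at hV hα
  funext i
  refine Fin.addCases (fun i => ?_) (fun j => ?_) i
  · exact hV _ hW0 i
  · have h1 := hα _ hβ0 j
    have h2 : a (Fin.natAdd k j) * c j = 0 := by exact_mod_cast h1
    simpa [hc j] using h2

section Kernel

variable {L : E →L[ℝ] (Fin n → ℝ)} {ξ : Fin n → E}

theorem linearIndependent_of_surjective_dual (hL : Function.Surjective L)
    (hξ : ∀ i v, η ![ξ i, v] = L v i) : LinearIndependent ℝ ξ := by
  rw [Fintype.linearIndependent_iff]
  intro a ha i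
  obtain ⟨v, hv⟩ := hL (Pi.single i 1)
  have h1 : contraction η (∑ i, a i • ξ i) v = 0 := by rw [ha]; simp
  simpa [contraction_apply, hξ, hv, Pi.single_apply] using h1

theorem finrank_ker_of_surjective (hE : Module.finrank ℂ E = n) (hL : Function.Surjective L) :
    Module.finrank ℝ (LinearMap.ker (L : E →ₗ[ℝ] (Fin n → ℝ))) = n := by
  have h1 := LinearMap.finrank_range_add_finrank_ker (L : E →ₗ[ℝ] (Fin n → ℝ))
  rw [LinearMap.range_eq_top.2 hL, finrank_top, finrank_real_of_complex, hE] at h1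
  simp at h1
  omega

/-- The kernel of a surjection whose components Poisson commute is isotropic. -/
theorem isotropic_of_ker (hE : Module.finrank ℂ E = n) (hL : Function.Surjective L)
    (hξ : ∀ i v, η ![ξ i, v] = L v i) (hcomm : ∀ i, L (ξ i) = 0) {v w : E} (hv : L v = 0)
    (hw : L w = 0) : η ![v, w] = 0 := by
  have hli := linearIndependent_of_surjective_dual hL hξ
  -- Commutation puts the n independent vectors ξ in the kernel, whose real dimension is 2n - n = n.
  have hspan : Submodule.span ℝ (Set.range ξ) = LinearMap.ker (L : E →ₗ[ℝ] (Fin n → ℝ)) := by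
    refine Submodule.eq_of_le_of_finrank_eq (Submodule.span_le.2 ?_) ?_
    · rintro _ ⟨i, rfl⟩
      exact hcomm i
    · rw [finrank_span_eq_card hli, finrank_ker_of_surjective hE hL, Fintype.card_fin]
  have hmem : v ∈ Submodule.span ℝ (Set.range ξ) := hspan ▸ hv
  have hle : Submodule.span ℝ (Set.range ξ) ≤
      LinearMap.ker ((contraction η).flip w : E →ₗ[ℝ] ℝ) := by
    refine Submodule.span_le.2 ?_
    rintro _ ⟨i, rfl⟩
    change η ![ξ i, w] = 0
    rw [hξ, hw, Pi.zero_apply]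
  exact hle hmem

/-- The phase of a complex form on the kernel is determined by its value on one basis. -/
theorem im_mul_eq_zero_of_ker (hE : Module.finrank ℂ E = n) (hL : Function.Surjective L)
    {e : Fin n → E} (he : LinearIndependent ℝ e) (heL : ∀ i, L (e i) = 0)
    {Ω : E [⋀^Fin n]→L[ℂ] ℂ} {z : ℂ} (hz : (z * Ω e).im = 0) {v : Fin n → E}
    (hv : ∀ i, L (v i) = 0) : (z * Ω v).im = 0 := by
  let N := LinearMap.ker (L : E →ₗ[ℝ] (Fin n → ℝ))
  let e' : Fin n → N := fun i => ⟨e i, heL i⟩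
  have he' : LinearIndependent ℝ e' := LinearIndependent.of_comp N.subtype he
  let bas := Module.Basis.mk he' (he'.span_eq_top_of_card_eq_finrank'
    (by rw [finrank_ker_of_surjective hE hL, Fintype.card_fin])).ge
  let f : N [⋀^Fin n]→ₗ[ℝ] ℝ :=
    (Complex.imLm ∘ₗ LinearMap.mulLeft ℝ z).compAlternatingMap
      ((Ω.restrictScalars ℝ).toAlternatingMap.compLinearMap N.subtype)
  have hf : f = 0 := by
    rw [← AlternatingMap.map_basis_eq_zero_iff bas, Module.Basis.coe_mk]
    exact hz
  exact DFunLike.congr_fun hf (fun i => (⟨v i, hv i⟩ : N))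

end Kernel

end PointwiseFibration

/-! ### The constant phase. -/

section Phase

/-- The matrix is i times a real one, so its determinant is i^m times a real number; the exponential
is (-i)^m. -/
theorem im_phase_mul_wedgeApply {E : Type*} [NormedAddCommGroup E] [NormedSpace ℂ E] {m : ℕ}
    {α : Fin m → E →L[ℂ] ℂ} {w : Fin m → E}
    (h : ∀ i j, (α i (w j)).re = 0) :
    (Complex.exp (((-(m * (Real.pi / 2)) : ℝ) : ℂ) * Complex.I) * wedgeApply α w).im = 0 := by
  let M : Matrix (Fin m) (Fin m) ℝ := Matrix.of fun i j => (α i (w j)).im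
  have hM : (Matrix.of fun i j => α i (w j)) = Complex.I • M.map Complex.ofRealHom := by
    ext i j
    apply Complex.ext <;> simp [M, h]
  have hexp : Complex.exp (((-(m * (Real.pi / 2)) : ℝ) : ℂ) * Complex.I) = (-Complex.I) ^ m := by
    have h1 : (((-(m * (Real.pi / 2)) : ℝ) : ℂ) * Complex.I) =
        m * (-(Real.pi / 2 * Complex.I)) := by
      push_cast
      ring
    rw [h1, Complex.exp_nat_mul, Complex.exp_neg, Complex.exp_pi_div_two_mul_I, Complex.inv_I]
  rw [wedgeApply, hM, Matrix.det_smul, Fintype.card_fin, hexp, ← mul_assoc, ← mul_pow]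
  have h2 : (M.map Complex.ofRealHom).det = (M.det : ℂ) := (RingHom.map_det _ M).symm
  rw [h2]
  simp

end Phase

section Components

variable {E : Type*} [NormedAddCommGroup E] [NormedSpace ℝ E]
  {X : Type*} [TopologicalSpace X] [ChartedSpace E X] {n : ℕ} {ρ : X → Fin n → ℝ} {x : X}

theorem realMFDeriv_component (hρ : MDifferentiableAt 𝓘(ℝ, E) 𝓘(ℝ, Fin n → ℝ) ρ x) (i : Fin n)
    (v : E) : realMFDeriv E ℝ (fun y => ρ y i) x v = realMFDeriv E (Fin n → ℝ) ρ x v i := by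
  have h1 := (ContinuousLinearMap.proj (R := ℝ) (φ := fun _ : Fin n => ℝ)
    i).hasFDerivAt.hasMFDerivAt.comp_normed_of_eq hρ.hasMFDerivAt rfl
  exact DFunLike.congr_fun h1.mfderiv v

theorem realMFDeriv_sub_const (hρ : MDifferentiableAt 𝓘(ℝ, E) 𝓘(ℝ, Fin n → ℝ) ρ x)
    (b : Fin n → ℝ) :
    realMFDeriv E (Fin n → ℝ) (fun y => ρ y - b) x = realMFDeriv E (Fin n → ℝ) ρ x := by
  have h1 := ((hasFDerivAt_id (𝕜 := ℝ) (ρ x)).sub_const b).hasMFDerivAt.comp_normed_of_eq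
    hρ.hasMFDerivAt rfl
  exact h1.mfderiv.trans (ContinuousLinearMap.id_comp _)

end Components

/-! ### Poisson commutation of invariants and pullbacks. -/

section Commuting

theorem PoissonCommuteAt.symm {E : Type*} [NormedAddCommGroup E] [NormedSpace ℂ E] {X : Type*}
    [TopologicalSpace X] [ChartedSpace E X] {κ : X → E [⋀^Fin 2]→L[ℝ] ℝ} {g h : X → ℝ}
    {x : X} (hgh : PoissonCommuteAt κ g h x) :
    PoissonCommuteAt κ h g x := fun v w hv hw => by
  rw [(κ x).map_pair_swap, hgh w v hw hv, neg_zero]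

variable {E : Type*} [NormedAddCommGroup E] [NormedSpace ℂ E] [FiniteDimensional ℂ E]
  {X : Type*} [TopologicalSpace X] [ChartedSpace E X] {κ : X → E [⋀^Fin 2]→L[ℝ] ℝ}

/-- Components of the moment map commute with invariant functions. -/
theorem IsHamiltonianTorusAction.poissonCommuteAt {k : ℕ} {act : (Fin k → Circle) → X → X}
    {μ : X → (Fin k → ℝ) →L[ℝ] ℝ} (h : IsHamiltonianTorusAction κ act μ) (hκ : IsKahlerForm κ)
    (v : Fin k → ℝ) {g : X → ℝ} {x : X} (hg : MDifferentiableAt 𝓘(ℝ, E) 𝓘(ℝ, ℝ) g x)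
    (hinv : ∀ t, g (act t x) = g x) : PoissonCommuteAt κ (fun y => μ y v) g x := by
  intro u w hu hw
  rw [hκ.isHamiltonianVector_unique hu (h.moment_eq v x), h.fundamentalVectorField_eq,
    (κ x).map_pair_swap, hw]
  exact neg_eq_zero.2 (h.realMFDeriv_orbitDeriv_eq_zero hg hinv v)

variable {E' : Type*} [NormedAddCommGroup E'] [NormedSpace ℂ E'] [FiniteDimensional ℂ E']
  {Y : Type*} [TopologicalSpace Y] [ChartedSpace E' Y] [T2Space Y] [IsManifold 𝓘(ℝ, E') ∞ Y]

/-- At a point where the map of a pseudotoric structure is a submersion, pullbacks of commuting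
functions commute. -/
theorem PseudotoricStructure.poissonCommuteAt_comp {k m : ℕ} {T : ToricKahlerStructure m E' Y}
    (P : PseudotoricStructure k κ T) (hκ : IsKahlerForm κ) {x : X} (hx : x ∉ P.base)
    {A : E →L[ℂ] E'} (hF : HasMFDerivAt 𝓘(ℂ, E) 𝓘(ℂ, E') P.map x A)
    (hsurj : Function.Surjective A)
    {g h : Y → ℝ} {U : Set Y} (hU : IsOpen U) (hxU : P.map x ∈ U)
    (hg : ContMDiffOn 𝓘(ℝ, E') 𝓘(ℝ, ℝ) ∞ g U) (hh : ContMDiffOn 𝓘(ℝ, E') 𝓘(ℝ, ℝ) ∞ h U)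
    (hgh : PoissonCommuteAt T.form g h (P.map x)) :
    PoissonCommuteAt κ (g ∘ P.map) (h ∘ P.map) x := by
  intro v w hv hw
  -- The pseudotoric condition concerns functions smooth on all of `Y`, so h is cut off. Only its
  -- germ at F(x) enters.
  obtain ⟨h', hh', heq⟩ := hh.exists_contMDiff_eventuallyEq hU hxU
  have hFr : HasMFDerivAt 𝓘(ℝ, E) 𝓘(ℝ, E') P.map x (realMFDeriv E E' P.map x) :=
    hF.real_of_complex.mdifferentiableAt.hasMFDerivAt
  have hFA : ∀ z, realMFDeriv E E' P.map x z = A z := fun z =>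
    DFunLike.congr_fun hF.real_of_complex.mfderiv z
  obtain ⟨φ, hφ⟩ := P.parallel h' hh'
  obtain ⟨Vg, hVg⟩ := T.kahler.exists_isHamiltonianVector g (P.map x)
  obtain ⟨Vh, hVh⟩ := T.kahler.exists_isHamiltonianVector h (P.map x)
  obtain ⟨l, hl, hlo⟩ := exists_contraction_horizontal_lift (hκ.pos x) hsurj Vh
  have hder : realMFDeriv E' ℝ h' (P.map x) = realMFDeriv E' ℝ h (P.map x) := heq.mfderiv_eq
  have heq' : h' ∘ P.map =ᶠ[𝓝 x] h ∘ P.map := hFr.1.eventually heq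
  have hder' : realMFDeriv E ℝ (h' ∘ P.map) x = realMFDeriv E ℝ (h ∘ P.map) x :=
    heq'.mfderiv_eq
  have hwl : w = φ x • l := by
    refine hφ x hx ?_ w Vh l ?_ ?_ ⟨?_, ?_⟩
    · intro u
      obtain ⟨z, hz⟩ := hsurj u
      exact ⟨z, (hFA z).trans hz⟩
    · exact fun z => (hw z).trans (DFunLike.congr_fun hder'.symm z)
    · exact fun z => (hVh z).trans (DFunLike.congr_fun hder.symm z)
    · exact (hFA l).trans hl
    · intro z hz
      exact hlo z ((hFA z).symm.trans hz)
  have hgd : HasMFDerivAt 𝓘(ℝ, E') 𝓘(ℝ, ℝ) g (P.map x) (realMFDeriv E' ℝ g (P.map x)) :=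
    ((hg.contMDiffAt (hU.mem_nhds hxU)).mdifferentiableAt (by simp)).hasMFDerivAt
  have hcomp := (hgd.comp_normed_of_eq hFr rfl).mfderiv
  have h1 : κ x ![v, w] = realMFDeriv E' ℝ g (P.map x) (realMFDeriv E E' P.map x w) :=
    (hv w).trans (DFunLike.congr_fun hcomp w)
  have h2 : realMFDeriv E' ℝ g (P.map x) Vh = 0 := (hVg Vh).symm.trans (hgh Vg Vh hVg hVh)
  rw [h1, hwl, map_smul, hFA, hl, map_smul, h2, smul_zero]

end Commuting

/-! ### The volume form off its poles. -/

section VolumeForm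

variable {E : Type*} [NormedAddCommGroup E] [NormedSpace ℂ E]
  {X : Type*} [TopologicalSpace X] [ChartedSpace E X]

theorem IsVolumeFormWithSimplePoles.isOpen_compl {n : ℕ} {Ω : X → E [⋀^Fin n]→L[ℂ] ℂ} {D : Set X}
    (h : IsVolumeFormWithSimplePoles Ω D) : IsOpen Dᶜ := by
  rw [isOpen_iff_mem_nhds]
  intro x hx
  obtain ⟨U, hU, hxU, s, η, hs, hD, -⟩ := h x
  have hsx : s x ≠ 0 := fun h0 => hx (hD.ge ⟨hxU, h0⟩ : x ∈ D ∩ U).1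
  have hc : ContinuousAt s x := hs.continuousOn.continuousAt (hU.mem_nhds hxU)
  filter_upwards [hU.mem_nhds hxU, hc.eventually_ne hsx] with y hy hsy hyD
  exact hsy (hD.le ⟨hyD, hy⟩ : y ∈ {y ∈ U | s y = 0}).2

theorem IsVolumeFormWithSimplePoles.ne_zero {n : ℕ} {Ω : X → E [⋀^Fin n]→L[ℂ] ℂ} {D : Set X}
    (h : IsVolumeFormWithSimplePoles Ω D) {x : X} (hx : x ∉ D) : Ω x ≠ 0 := by
  obtain ⟨U, hU, hxU, s, η, hs, hD, -, -, hη, hηs⟩ := h x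
  intro h0
  apply hη x hxU
  rw [hηs x ⟨hxU, hx⟩, h0]
  ext v
  exact mul_zero (s x)

end VolumeForm

/-! ### Torus directions and the volume form. -/

section Fibration

variable {E : Type*} [NormedAddCommGroup E] [NormedSpace ℂ E]
  {X : Type*} [TopologicalSpace X] [ChartedSpace E X] {κ : X → E [⋀^Fin 2]→L[ℝ] ℝ}
  {k m : ℕ} {act : (Fin k → Circle) → X → X} {μ : X → (Fin k → ℝ) →L[ℝ] ℝ}

theorem IsHamiltonianTorusAction.contraction_orbitDeriv (h : IsHamiltonianTorusAction κ act μ)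
    (v : Fin k → ℝ) (x : X) (w : E) :
    κ x ![orbitDeriv E act x v, w] = realMFDeriv E ℝ (fun y => μ y v) x w := by
  rw [← h.fundamentalVectorField_eq]
  exact h.moment_eq v x w

theorem IsHamiltonianTorusAction.contMDiff_moment_apply (h : IsHamiltonianTorusAction κ act μ)
    (v : Fin k → ℝ) : ContMDiff 𝓘(ℝ, E) 𝓘(ℝ, ℝ) ∞ fun y => μ y v :=
  (ContinuousLinearMap.apply ℝ ℝ v).contMDiff.comp h.smooth_moment

/-- The pairing is the derivative of a moment component along an orbit, where it is constant. -/
theorem IsHamiltonianTorusAction.isotropic_orbitDeriv (h : IsHamiltonianTorusAction κ act μ)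
    (x : X) (v w : Fin k → ℝ) :
    κ x ![orbitDeriv E act x v, orbitDeriv E act x w] = 0 := by
  rw [h.contraction_orbitDeriv]
  exact h.realMFDeriv_orbitDeriv_eq_zero
    ((h.contMDiff_moment_apply v).mdifferentiable (by simp) x)
    (fun t => by rw [h.moment_invariant]) w

/-- Where the stabilizer is finite, contracting a nonzero top-degree form with the generating vector
fields of a basis gives a nonzero form. -/
theorem IsHamiltonianTorusAction.exists_append_ne_zero [FiniteDimensional ℂ E]
    (h : IsHamiltonianTorusAction κ act μ)
    (hκ : IsKahlerForm κ) (hE : Module.finrank ℂ E = k + m) {x : X}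
    (hx : Function.Injective (orbitDeriv E act x)) (b : Module.Basis (Fin k) ℝ (Fin k → ℝ))
    {Ω : E [⋀^Fin (k + m)]→L[ℂ] ℂ} (hΩ : Ω ≠ 0) :
    ∃ w : Fin m → E,
      Ω (Fin.append (fun i : Fin k => fundamentalVectorField act (b i.rev) x) w) ≠ 0 := by
  simp only [h.fundamentalVectorField_eq]
  have hli : LinearIndependent ℝ fun i : Fin k => orbitDeriv E act x (b i.rev) :=
    (b.linearIndependent.map' (orbitDeriv E act x : (Fin k → ℝ) →ₗ[ℝ] E)
      (LinearMap.ker_eq_bot.2 hx)).comp Fin.rev Fin.rev_injective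
  exact _root_.exists_append_ne_zero hE hΩ
    (hli.complex_of_isotropic (hκ.pos x) fun i j => h.isotropic_orbitDeriv x _ _)

theorem dlog_comp {E' : Type*} [NormedAddCommGroup E'] [NormedSpace ℂ E'] {Y : Type*}
    [TopologicalSpace Y] [ChartedSpace E' Y] {F : X → Y} {g : Y → ℂ} {x : X} {A : E →L[ℂ] E'}
    (hF : HasMFDerivAt 𝓘(ℂ, E) 𝓘(ℂ, E') F x A)
    (hg : MDifferentiableAt 𝓘(ℂ, E') 𝓘(ℂ, ℂ) g (F x)) :
    dlog (g ∘ F) x = (dlog g (F x)).comp A := by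
  have h1 := (HasMFDerivAt.comp x hg.hasMFDerivAt hF).mfderiv
  ext v
  have h2 := DFunLike.congr_fun h1 v
  exact congrArg ((g (F x))⁻¹ * ·) h2

theorem ContMDiffOn.norm_of_complex {g : X → ℂ} {U : Set X}
    (hg : ContMDiffOn 𝓘(ℂ, E) 𝓘(ℂ, ℂ) ω g U) (h0 : ∀ x ∈ U, g x ≠ 0) :
    ContMDiffOn 𝓘(ℝ, E) 𝓘(ℝ, ℝ) ∞ (fun x => ‖g x‖) U := fun x hx =>
  (contDiffAt_norm ℝ (h0 x hx)).contMDiffAt.comp_contMDiffWithinAt x (hg.real_of_complex x hx)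

end Fibration

/-! ### The special Lagrangian fibration. -/

theorem proposition3p1
    {k m : ℕ} (hk : 1 ≤ k)
    {E : Type*} [NormedAddCommGroup E] [NormedSpace ℂ E] [FiniteDimensional ℂ E]
    (hE : Module.finrank ℂ E = k + m)
    {X : Type*} [TopologicalSpace X] [T2Space X] [SecondCountableTopology X] [ConnectedSpace X]
    [ChartedSpace E X] [IsManifold 𝓘(ℂ, E) ω X]
    {E' : Type*} [NormedAddCommGroup E'] [NormedSpace ℂ E'] [FiniteDimensional ℂ E']
    (hE' : Module.finrank ℂ E' = m)
    {Y : Type*} [TopologicalSpace Y] [T2Space Y] [SecondCountableTopology Y]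
    [ChartedSpace E' Y] [IsManifold 𝓘(ℂ, E') ω Y]
    -- the Kähler manifold `X`, the toric Kähler manifold `Y`, and the pseudotoric structure
    (ωX : X → E [⋀^Fin 2]→L[ℝ] ℝ) (hωX : IsKahlerForm ωX)
    (T : ToricKahlerStructure m E' Y)
    (P : PseudotoricStructure k ωX T)
    -- the meromorphic volume form and its polar divisor
    (D : Set X) (ΩX : X → E [⋀^Fin (k + m)]→L[ℂ] ℂ)
    (hΩ : IsVolumeFormWithSimplePoles ΩX D)
    -- (i)
    (hD : ∀ t, ∀ x ∈ D, P.act t x ∈ D)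
    -- (ii)
    (hBD : P.base ⊆ D)
    (hF : ∀ x ∉ D, P.map x ∉ T.toricDivisor)
    -- a basis of `Lie(Tᵏ)` and the functions `f₁, …, f_m`
    (b : Module.Basis (Fin k) ℝ (Fin k → ℝ))
    (f : Fin m → Y → ℂ)
    (hf_mero : ∀ j, IsMeromorphicFunction (E' := E') (f j))
    (hf_hol : ∀ j, ContMDiffOn 𝓘(ℂ, E') 𝓘(ℂ, ℂ) ω (f j) T.openOrbit)
    (hf_ne : ∀ j, ∀ x ∉ D, f j (P.map x) ≠ 0)
    -- (iii): `ι_{V₁} ⋯ ι_{V_k} Ω = d log F^*f₁ ∧ ⋯ ∧ d log F^*f_m`; the left-hand side evaluated on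
    -- `w` is `Ω(V_k, …, V₁, w₁, …, w_m)`
    (hΩf : ∀ x ∉ D, ∀ w : Fin m → E,
      ΩX x (Fin.append (fun i : Fin k => fundamentalVectorField P.act (b i.rev) x) w) =
        wedgeApply (fun j => dlog (f j ∘ P.map) x) w)
    -- (iv)
    (hf_comm : ∀ i j, ∀ y ∈ T.openOrbit, f i y ≠ 0 → f j y ≠ 0 →
      PoissonCommuteAt T.form (fun z => ‖f i z‖) (fun z => ‖f j z‖) y) :
    IsSpecialLagrangianFibrationOn ωX ΩX
      (fun x => Fin.append (fun i : Fin k => P.moment x (b i))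
        (fun j : Fin m => ‖f j (P.map x)‖)) Dᶜ := by
  have hXr : IsManifold 𝓘(ℝ, E) ∞ X := isManifold_real_of_complex E X
  have hYr : IsManifold 𝓘(ℝ, E') ∞ Y := isManifold_real_of_complex E' Y
  have hH := P.hamiltonian
  have hDo : IsOpen Dᶜ := hΩ.isOpen_compl
  have hxB : ∀ x ∉ D, x ∉ P.base := fun x hx hB => hx (hBD hB)
  have horb : ∀ x ∉ D, P.map x ∈ T.openOrbit := fun x hx => Set.notMem_compl_iff.1 (hF x hx)
  have hFs : ContMDiffOn 𝓘(ℂ, E) 𝓘(ℂ, E') ω P.map Dᶜ := P.meromorphic.holomorphic.mono hxB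
  have hgs : ∀ j, ContMDiffOn 𝓘(ℂ, E) 𝓘(ℂ, ℂ) ω (f j ∘ P.map) Dᶜ := fun j =>
    (hf_hol j).comp hFs horb
  have hgd : ∀ j, ∀ x ∉ D, MDifferentiableAt 𝓘(ℂ, E) 𝓘(ℂ, ℂ) (f j ∘ P.map) x := fun j x hx =>
    ((hgs j).contMDiffAt (hDo.mem_nhds hx)).mdifferentiableAt (by simp)
  have hνs : ∀ j, ContMDiffOn 𝓘(ℝ, E) 𝓘(ℝ, ℝ) ∞ (fun x => ‖f j (P.map x)‖) Dᶜ := fun j =>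
    (hgs j).norm_of_complex fun x hx => hf_ne j x hx
  have hνd : ∀ j, ∀ x ∉ D, MDifferentiableAt 𝓘(ℝ, E) 𝓘(ℝ, ℝ) (fun x => ‖f j (P.map x)‖) x :=
    fun j x hx => ((hνs j).contMDiffAt (hDo.mem_nhds hx)).mdifferentiableAt (by simp)
  have hμs : ∀ i, ContMDiff 𝓘(ℝ, E) 𝓘(ℝ, ℝ) ∞ fun x => P.moment x (b i) := fun i =>
    hH.contMDiff_moment_apply (b i)
  -- the points with finite stabilizer
  set N : Set X := {x | Function.Injective (orbitDeriv E P.act x)} with hN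
  have hNd : Dense N := hH.dense_injective_orbitDeriv P.locally_effective
  have hcl : ∀ x ∉ D, x ∈ closure (Dᶜ ∩ N) := fun x hx =>
    hNd.open_subset_closure_inter hDo hx
  have hwedge : ∀ x ∉ D, x ∈ N →
      ∃ w : Fin m → E, wedgeApply (fun j => dlog (f j ∘ P.map) x) w ≠ 0 := by
    intro x hx hxN
    obtain ⟨w, hw⟩ := hH.exists_append_ne_zero hωX hE hxN b (hΩ.ne_zero hx)
    exact ⟨w, by rwa [← hΩf x hx]⟩
  have hνν : ∀ i j, ∀ x ∉ D, PoissonCommuteAt ωX (fun x => ‖f i (P.map x)‖)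
      (fun x => ‖f j (P.map x)‖) x := by
    intro i j x hx
    -- F need not be a submersion at x. The bracket is computed at nearby points with finite
    -- stabilizer, where it is, and vanishes at x by continuity.
    refine hωX.poissonCommuteAt_of_mem_closure hDo (hνs i) (hνs j) Set.inter_subset_left ?_ hx
      (hcl x hx)
    rintro y ⟨hy, hyN⟩
    have hopen : ∀ j, IsOpen (T.openOrbit ∩ f j ⁻¹' {0}ᶜ) := fun j =>
      (hf_hol j).continuousOn.isOpen_inter_preimage T.isOpen_orbit isOpen_compl_singleton
    have hsmooth : ∀ j, ContMDiffOn 𝓘(ℝ, E') 𝓘(ℝ, ℝ) ∞ (fun y => ‖f j y‖)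
        (T.openOrbit ∩ f j ⁻¹' {0}ᶜ) := fun j =>
      ((hf_hol j).mono Set.inter_subset_left).norm_of_complex fun y hy => hy.2
    have hmem : ∀ j, P.map y ∈ T.openOrbit ∩ f j ⁻¹' {0}ᶜ := fun j => ⟨horb y hy, hf_ne j y hy⟩
    obtain ⟨A, hFd⟩ : ∃ A : E →L[ℂ] E', HasMFDerivAt 𝓘(ℂ, E) 𝓘(ℂ, E') P.map y A :=
      ⟨_, ((hFs.contMDiffAt (hDo.mem_nhds hy)).mdifferentiableAt (by simp)).hasMFDerivAt⟩
    obtain ⟨w, hw⟩ := hwedge y hy hyN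
    have hdlog : (fun j => dlog (f j ∘ P.map) y) =
        fun j => (dlog (E := E') (f j) (P.map y)).comp A :=
      funext fun j => dlog_comp hFd (((hf_hol j).contMDiffAt
        (T.isOpen_orbit.mem_nhds (horb y hy))).mdifferentiableAt (by simp))
    rw [hdlog] at hw
    exact P.poissonCommuteAt_comp hωX (hxB y hy) hFd
      (surjective_of_wedgeApply_comp_ne_zero hE' hw) ((hopen i).inter (hopen j))
      ⟨hmem i, hmem j⟩ ((hsmooth i).mono Set.inter_subset_left)
      ((hsmooth j).mono Set.inter_subset_right)
      (hf_comm i j _ (horb y hy) (hf_ne i y hy) (hf_ne j y hy))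
  set ρ : X → Fin (k + m) → ℝ := fun x => Fin.append (fun i : Fin k => P.moment x (b i))
    (fun j : Fin m => ‖f j (P.map x)‖) with hρ
  have hρ₁ : ∀ i, (fun x => ρ x (Fin.castAdd m i)) = fun x => P.moment x (b i) := fun i => by
    funext x; simp [hρ]
  have hρ₂ : ∀ j, (fun x => ρ x (Fin.natAdd k j)) = fun x => ‖f j (P.map x)‖ := fun j => by
    funext x; simp [hρ]
  have hρs : ContMDiffOn 𝓘(ℝ, E) 𝓘(ℝ, Fin (k + m) → ℝ) ∞ ρ Dᶜ := by
    rw [contMDiffOn_pi_space]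
    intro i
    refine Fin.addCases (fun i => ?_) (fun j => ?_) i
    · rw [hρ₁]
      exact (hμs i).contMDiffOn
    · rw [hρ₂]
      exact hνs j
  have hρd : ∀ x ∉ D, MDifferentiableAt 𝓘(ℝ, E) 𝓘(ℝ, Fin (k + m) → ℝ) ρ x := fun x hx =>
    (hρs.contMDiffAt (hDo.mem_nhds hx)).mdifferentiableAt (by simp)
  have hpoisson : ∀ i j, ∀ x ∉ D,
      PoissonCommuteAt ωX (fun y => ρ y i) (fun y => ρ y j) x := by
    intro i j x hx
    have hμν : ∀ i j, PoissonCommuteAt ωX (fun x => P.moment x (b i))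
        (fun x => ‖f j (P.map x)‖) x := fun i j =>
      hH.poissonCommuteAt hωX (b i) (hνd j x hx) fun t => by rw [P.map_invariant t x (hxB x hx)]
    refine Fin.addCases (fun i => ?_) (fun i => ?_) i <;>
      refine Fin.addCases (fun j => ?_) (fun j => ?_) j
    · rw [hρ₁, hρ₁]
      exact hH.poissonCommuteAt hωX (b i) ((hμs j).mdifferentiable (by simp) x)
        fun t => by rw [hH.moment_invariant]
    · rw [hρ₁, hρ₂]
      exact hμν i j
    · rw [hρ₂, hρ₁]
      exact (hμν j i).symm
    · rw [hρ₂, hρ₂]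
      exact hνν i j x hx
  have hL₁ : ∀ x ∉ D, ∀ i v, realMFDeriv E (Fin (k + m) → ℝ) ρ x v (Fin.castAdd m i) =
      ωX x ![orbitDeriv E P.act x (b i), v] := fun x hx i v => by
    rw [← realMFDeriv_component (hρd x hx), hρ₁, hH.contraction_orbitDeriv]
  have hL₂ : ∀ x ∉ D, ∀ j v, realMFDeriv E (Fin (k + m) → ℝ) ρ x v (Fin.natAdd k j) =
      ‖f j (P.map x)‖ * (dlog (f j ∘ P.map) x v).re := fun x hx j v => by
    rw [← realMFDeriv_component (hρd x hx), hρ₂]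
    exact realMFDeriv_norm_apply (hgd j x hx) (hf_ne j x hx) v
  have hdlogV : ∀ x ∉ D, ∀ j v, dlog (f j ∘ P.map) x (orbitDeriv E P.act x v) = 0 := by
    intro x hx j v
    have h1 := hH.realMFDeriv_orbitDeriv_eq_zero (V := ℂ)
      (hgd j x hx).hasMFDerivAt.real_of_complex.mdifferentiableAt
      (fun t => congrArg (f j) (P.map_invariant t x (hxB x hx))) v
    rw [realMFDeriv_eq (hgd j x hx)] at h1
    exact (congrArg ((f j (P.map x))⁻¹ * ·) h1).trans (mul_zero _)
  have hreg : Dᶜ ∩ N ⊆ regularLocus (E := E) ρ Dᶜ := by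
    rintro x ⟨hx, hxN⟩
    obtain ⟨w, hw⟩ := hwedge x hx hxN
    refine ⟨hx, surjective_of_dual_of_re (hωX.pos x) ?_ (linearIndependent_of_wedgeApply_ne_zero hw)
      (fun j i => hdlogV x hx j (b i)) (fun j => norm_ne_zero_iff.2 (hf_ne j x hx))
      (hL₁ x hx) (hL₂ x hx)⟩
    exact b.linearIndependent.map' (orbitDeriv E P.act x : (Fin k → ℝ) →ₗ[ℝ] E)
      (LinearMap.ker_eq_bot.2 hxN)
  have hopenreg := isOpen_regularLocus hDo hρs
  -- One phase serves all fibres: each of the m imaginary rows of the determinant contributes a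
  -- quarter turn. The regular part of each fibre is cut out by ρ - c.
  refine ⟨hDo, hρs, hpoisson, hopenreg, fun x hx => closure_mono hreg (hcl x hx),
    -(m * (Real.pi / 2)), fun c x hx => ⟨regularLocus (E := E) ρ Dᶜ, hopenreg, hx.1,
      fun y => ρ y - c, (hρs.mono fun y hy => hy.1).sub contMDiffOn_const, fun y hy => ?_, ?_,
      fun y hy => ?_⟩⟩
  · change Function.Surjective (realMFDeriv E (Fin (k + m) → ℝ) (fun y => ρ y - c) y)
    rw [realMFDeriv_sub_const (hρd y hy.1)]
    exact hy.2
  · ext y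
    exact ⟨fun hy => ⟨hy.2, sub_eq_zero.2 hy.1.2⟩, fun hy => ⟨⟨hy.1, sub_eq_zero.1 hy.2⟩, hy.1⟩⟩
  · have hyD : y ∉ D := hy.2.1
    have hker : ∀ v, realMFDeriv E (Fin (k + m) → ℝ) (fun y => ρ y - c) y v =
        realMFDeriv E (Fin (k + m) → ℝ) ρ y v := fun v => by
      rw [realMFDeriv_sub_const (hρd y hyD)]
    have hsurj : Function.Surjective (realMFDeriv E (Fin (k + m) → ℝ) ρ y) := hy.2.2
    choose ξ hξ using fun i => hωX.exists_isHamiltonianVector (fun z => ρ z i) y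
    have hξL : ∀ i v, ωX y ![ξ i, v] = realMFDeriv E (Fin (k + m) → ℝ) ρ y v i := fun i v =>
      (hξ i v).trans (realMFDeriv_component (hρd y hyD) i v)
    have hcomm : ∀ i, realMFDeriv E (Fin (k + m) → ℝ) ρ y (ξ i) = 0 := fun i => by
      funext j
      rw [← hξL]
      exact hpoisson j i y hyD _ _ (hξ j) (hξ i)
    refine ⟨fun v w hv hw => isotropic_of_ker hE hsurj hξL hcomm ((hker v).symm.trans hv)
      ((hker w).symm.trans hw), fun v hv => ?_⟩
    have hξ₁ : ∀ i, ξ (Fin.castAdd m i) = fundamentalVectorField P.act (b i) y := fun i => by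
      have h1 := hξ (Fin.castAdd m i)
      rw [hρ₁] at h1
      exact hωX.isHamiltonianVector_unique h1 (hH.moment_eq (b i) y)
    -- Reverses the torus block, matching the order V_k, …, V_1 in which the iterated contraction
    -- feeds Ω.
    let σ : Fin (k + m) → Fin (k + m) :=
      Fin.append (fun i => Fin.castAdd m i.rev) (fun j => Fin.natAdd k j)
    have hσ : Function.Injective σ := by
      have hσσ : ∀ i, σ (σ i) = i := fun i => by
        refine Fin.addCases (fun i => ?_) (fun j => ?_) i <;> simp [σ]
      exact fun i j hij => by rw [← hσσ i, hij, hσσ]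
    have hσξ : ξ ∘ σ = Fin.append (fun i => fundamentalVectorField P.act (b i.rev) y)
        (fun j => ξ (Fin.natAdd k j)) := by
      funext i
      refine Fin.addCases (fun i => ?_) (fun j => ?_) i <;> simp [σ, hξ₁]
    refine im_mul_eq_zero_of_ker hE hsurj
      ((linearIndependent_of_surjective_dual hsurj hξL).comp σ hσ) (fun i => hcomm _) ?_
      (fun i => (hker (v i)).symm.trans (hv i))
    rw [hσξ, hΩf y hyD]
    refine im_phase_mul_wedgeApply fun i j => ?_
    -- Since dρ kills every ξ, the product |f_i| Re d log F^*f_i vanishes on it, so the matrix entry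
    -- is imaginary.
    have h1 := hL₂ y hyD i (ξ (Fin.natAdd k j))
    rw [hcomm, Pi.zero_apply] at h1
    exact (mul_eq_zero.1 h1.symm).resolve_left (norm_ne_zero_iff.2 (hf_ne i y hyD))
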